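/- **Setting.** Let $d\ge 1$ and let $A_n\in\mathbb R^{d,d}$, $n\in\mathbb N_0$, be invertible with $\sup_n\|A_n\|<\infty$ and $\sup_n\|A_n^{-1}\|<\infty$. Let $\Phi(n,m)$, $n,m\in\mathbb N_0$, be the solution operator of $u_{n+1}=A_nu_n$, that is $\Phi(n,n)=I$, $\Phi(n,m)=A_{n-1}\cdots A_m$ for $n>m$, and $\Phi(n,m)=\Phi(m,n)^{-1}$ for $n<m$. The equation has an exponential dichotomy (ED) on $\mathbb N_0$ with projectors $P_n$ if there are $K>0$ and $\alpha_s,\alpha_u\in(0,1)$ such that $P_n^2=P_n$, $P_n\Phi(n,m)=\Phi(n,m)P_m$ for all $n,m\in\mathbb N_0$, and $\|\Phi(n,m)P_m\|\le K\alpha_s^{n-m}$, $\|\Phi(m,n)(I-P_n)\|\le K\alpha_u^{n-m}$ for all $n\ge m\geq 0$. The dichotomy spectrum $\Sigma_{\rm ED}$ is the set of all $\gamma>0$ for which the scaled equation $u_{n+1}=\gamma^{-1}A_nu_n$ has no ED on $\mathbb N_0$. Let $$\Sigma_{\rm ED}=\bigcup_{i=1}^{\ell}[\sigma_i^-,\sigma_i^+],\qquad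 0<\sigma_\ell^-\le\sigma_\ell^+<\dots<\sigma_1^-\le\sigma_1^+,$$ and put $R_1=(\sigma_1^+,\infty)$, $R_i=(\sigma_i^+,\sigma_{i-1}^-)$ for $2\le i\le\ell$, and $R_{\ell+1}=(0,\sigma_\ell^-)$. For each $i=1,\dots,\ell+1$ let $(P_{n,i})_{n\in\mathbb N_0}$ be any family of dichotomy projectors of the equation scaled by some $\gamma_i\in R_i$. The spectral fibers are $$\mathcal W_n^i=\operatorname{range}(P_{n,i})\cap\operatorname{range}(I-P_{n,i+1}),\qquad i=1,\dots,\ell .$$ Let $\mathcal G(s,d)$ be the set of $s$-dimensional subspaces of $\mathbb R^d$, and let $\mathcal D_0(s,d)$ be the set of trace spaces at time $0$, that is of all $V\in\mathcal G(s,d)$ of the form $V=\bigoplus_{i=1}^\ell W_i$ with subspaces $W_i\subseteq\mathcal W_0^i$ and $\sum_i\dim W_i=s$. Let $\measuredangle(V,W)$ denote the largest principal angle of two subspaces of equal dimension; its cosine is the smallest singular value of $V_B^\top W_B$, where the columns of $V_B,W_B$ are orthonormal bases of $V,W$. Put $$a_{m,n}(V)=\sum_{j=m}^{n}\measuredangle\big(\Phi(j-1,0)V,\Phi(j,0)V\big),\qquad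 m\geq 1,$$ and $a_{m,n}(v)=a_{m,n}(\operatorname{span}(v))$ for $v\in\mathbb R^d$, $v\ne0$. The upper and lower $s$-th uniform outer angular values and the $s$-th upper uniform inner angular value are $$\hat\theta_{[s]}=\sup_{V\in\mathcal G(s,d)}\lim_{n\to\infty}\frac1n\sup_{k\in\mathbb N_0}a_{k+1,k+n}(V),\qquad \underline{\hat\theta}_{[s]}=\sup_{V\in\mathcal G(s,d)}\lim_{n\to\infty}\frac1n\inf_{k\in\mathbb N_0}a_{k+1,k+n}(V),$$ $$\overline\theta_{[s]}=\lim_{n\to\infty}\frac1n\sup_{V\in\mathcal G(s,d)}\sup_{k\in\mathbb N_0}a_{k+1,k+n}(V).$$ For a subspace $V\subseteq\mathbb R^d$ put $$\overline\theta_{[1]}(V)=\lim_{n\to\infty}\ \sup_{v\in V,\,v\ne0}\ \sup_{k\in\mathbb N_0}\frac1n a_{k+1,k+n}(v).$$ **Theorem.** The limits in the following formulas and in the definitions of $\hat\theta_{[s]}$, $\underline{\hat\theta}_{[s]}$ ($1\le s\le d$), $\overline\theta_{[1]}$ and $\overline\theta_{[1]}(\mathcal W_0^i)$ ($1\le i\le\ell$)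 exist. For $s=1,\dots,d$, $$\hat\theta_{[s]}=\sup_{V\in\mathcal D_0(s,d)}\ \lim_{n\to\infty}\ \sup_{k\in\mathbb N_0}\frac1n a_{k+1,k+n}(V),\qquad \underline{\hat\theta}_{[s]}=\sup_{V\in\mathcal D_0(s,d)}\ \lim_{n\to\infty}\ \inf_{k\in\mathbb N_0}\frac1n a_{k+1,k+n}(V).$$ Moreover, $$\overline\theta_{[1]}=\max_{i=1,\dots,\ell}\overline\theta_{[1]}(\mathcal W_0^i).$$ -/

import Mathlib

open Filter Topology

noncomputable section

namespace AngVal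

/-- The state space `ℝ^d` with the Euclidean inner product and norm. -/
abbrev E (d : ℕ) : Type := EuclideanSpace ℝ (Fin d)

/-- The linear operators on `ℝ^d` with the operator norm (real `d × d` matrices with the spectral
norm). -/
abbrev Op (d : ℕ) : Type := E d →L[ℝ] E d

variable {d : ℕ}

/-! ### The difference equation and its solution operator

A system `u (n+1) = A n u n`, `n ∈ ℕ`, with invertible `A n` is a sequence of units of `Op d`. -/

/-- `A n` and its inverse are bounded uniformly in `n`. -/
def BoundedInvertible (A : ℕ → (Op d)ˣ) : Prop :=
  ∃ C : ℝ, ∀ n, ‖(A n : Op d)‖ ≤ C ∧ ‖(((A n)⁻¹ : (Op d)ˣ) : Op d)‖ ≤ C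

/-- The product `A (n-1) * ... * A 0`. -/
def fromZero (A : ℕ → (Op d)ˣ) : ℕ → (Op d)ˣ
  | 0 => 1
  | n + 1 => A n * fromZero A n

/-- The solution operator `Φ(n,m)`, for all `n, m`. -/
def Phi (A : ℕ → (Op d)ˣ) (n m : ℕ) : (Op d)ˣ :=
  fromZero A n * (fromZero A m)⁻¹

theorem Phi_self (A : ℕ → (Op d)ˣ) (n : ℕ) : Phi A n n = 1 := by
  simp [Phi]

theorem Phi_succ_left (A : ℕ → (Op d)ˣ) (n m : ℕ) : Phi A (n + 1) m = A n * Phi A n m := by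
  simp [Phi, fromZero, mul_assoc]

theorem Phi_succ_right (A : ℕ → (Op d)ˣ) (n m : ℕ) : Phi A n (m + 1) = Phi A n m * (A m)⁻¹ := by
  simp [Phi, fromZero, mul_assoc]

/-- The scaled system `u (n+1) = γ⁻¹ A n u n`. -/
def scaled (A : ℕ → (Op d)ˣ) (γ : ℝˣ) : ℕ → (Op d)ˣ :=
  fun n => Units.map (algebraMap ℝ (Op d) : ℝ →* Op d) γ⁻¹ * A n

theorem coe_scaled (A : ℕ → (Op d)ˣ) (γ : ℝˣ) (n : ℕ) :
    (scaled A γ n : Op d) = (γ : ℝ)⁻¹ • (A n : Op d) := by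
  simpa [scaled] using (Algebra.smul_def (γ : ℝ)⁻¹ (A n : Op d)).symm

/-! ### Exponential dichotomies and the dichotomy spectrum (on the time axis `ℕ`) -/

/-- The system `A` has an exponential dichotomy on `ℕ` with stable projectors `P n` and unstable
projectors `1 - P n`, constant `K` and rates `αs`, `αu`. (Invariance of the projectors `1 - P n`
is equivalent to that of the `P n`.) -/
structure IsDichotomy (A : ℕ → (Op d)ˣ) (K αs αu : ℝ) (P : ℕ → Op d) : Prop where
  K_pos : 0 < K
  αs_mem : αs ∈ Set.Ioo (0 : ℝ) 1
  αu_mem : αu ∈ Set.Ioo (0 : ℝ) 1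
  proj : ∀ n, P n * P n = P n
  invariant : ∀ n m, P n * (Phi A n m : Op d) = (Phi A n m : Op d) * P m
  stable : ∀ n m, m ≤ n → ‖(Phi A n m : Op d) * P m‖ ≤ K * αs ^ (n - m)
  unstable : ∀ n m, m ≤ n → ‖(Phi A m n : Op d) * (1 - P n)‖ ≤ K * αu ^ (n - m)

/-- `P` is a family of (stable) dichotomy projectors of the system `A`. -/
def IsDichotomyProjector (A : ℕ → (Op d)ˣ) (P : ℕ → Op d) : Prop :=
  ∃ K αs αu : ℝ, IsDichotomy A K αs αu P

/-- The system `A` has an exponential dichotomy on `ℕ`. -/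
def HasDichotomy (A : ℕ → (Op d)ˣ) : Prop := ∃ P : ℕ → Op d, IsDichotomyProjector A P

/-- The dichotomy (Sacker-Sell) spectrum: all `γ > 0` whose scaled system has no exponential
dichotomy. -/
def dichotomySpectrum (A : ℕ → (Op d)ˣ) : Set ℝ :=
  {x | 0 < x ∧ ∀ γ : ℝˣ, (γ : ℝ) = x → ¬ HasDichotomy (scaled A γ)}

/-- The dichotomy spectrum of `A` is the disjoint union of the `ℓ` compact intervals
`[σm i, σp i] ⊆ (0,∞)`, numbered in decreasing order (`i = 0` is the rightmost one). -/
structure HasSpectralIntervals (A : ℕ → (Op d)ˣ) {ℓ : ℕ} (σm σp : Fin ℓ → ℝ) : Prop where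
  pos : ∀ i, 0 < σm i
  le : ∀ i, σm i ≤ σp i
  lt : ∀ i j, i < j → σp j < σm i
  spectrum_eq : dichotomySpectrum A = ⋃ i, Set.Icc (σm i) (σp i)

/-- The `p`-th resolvent interval, `p = 0, ..., ℓ`: it lies below the spectral intervals with
number `< p` and above those with number `≥ p`. So it is `(σp 0, ∞)` for `p = 0`, it is
`(σp p, σm (p-1))` for `0 < p < ℓ`, and it is `(0, σm (ℓ-1))` for `p = ℓ`. -/
def resolventInterval {ℓ : ℕ} (σm σp : Fin ℓ → ℝ) (p : Fin (ℓ + 1)) : Set ℝ :=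
  {x | 0 < x ∧ (∀ j : Fin ℓ, j.castSucc < p → x < σm j) ∧ ∀ j : Fin ℓ, p ≤ j.castSucc → σp j < x}

/-- `P p` (`p = 0, ..., ℓ`) is a family of dichotomy projectors of the system scaled by some
element of the `p`-th resolvent interval. -/
def IsProjectorSystem (A : ℕ → (Op d)ˣ) {ℓ : ℕ} (σm σp : Fin ℓ → ℝ)
    (P : Fin (ℓ + 1) → ℕ → Op d) : Prop :=
  ∀ p, ∃ γ : ℝˣ, (γ : ℝ) ∈ resolventInterval σm σp p ∧ IsDichotomyProjector (scaled A γ) (P p)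

/-- The `i`-th spectral fiber at time `n`: the intersection of the range of the stable projector
to the right of the `i`-th spectral interval with the range of the unstable projector to its
left. -/
def fiber {ℓ : ℕ} (P : Fin (ℓ + 1) → ℕ → Op d) (n : ℕ) (i : Fin ℓ) : Submodule ℝ (E d) :=
  (P i.castSucc n : E d →ₗ[ℝ] E d).range ⊓ ((1 - P i.succ n : Op d) : E d →ₗ[ℝ] E d).range

/-- The Grassmannian `G(s,d)`: the `s`-dimensional subspaces of `ℝ^d`. -/
def grassmannian (s d : ℕ) : Set (Submodule ℝ (E d)) := {V | Module.finrank ℝ V = s}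

/-- The trace spaces `D_k(s,d)` at time `k`: the `s`-dimensional subspaces that are direct sums of
subspaces of the spectral fibers at time `k`. -/
def traceSpaces {ℓ : ℕ} (P : Fin (ℓ + 1) → ℕ → Op d) (k s : ℕ) : Set (Submodule ℝ (E d)) :=
  {V | V ∈ grassmannian s d ∧ ∃ W : Fin ℓ → Submodule ℝ (E d),
    (∀ i, W i ≤ fiber P k i) ∧ iSupIndep W ∧ V = ⨆ i, W i ∧ ∑ i, Module.finrank ℝ (W i) = s}

/-! ### Angles and angular values -/

/-- The largest principal angle between subspaces `V`, `W` of equal positive dimension `s`: its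
cosine is the smallest (that is, the `s`-th) singular value of the orthogonal projection from `V`
to `W`, whose matrix in orthonormal bases (the columns of `V_B`, `W_B`) is `W_Bᵀ V_B`. Singular
values are numbered decreasingly from `0`. -/
def ang (V W : Submodule ℝ (E d)) : ℝ :=
  Real.arccos
    (((W.orthogonalProjectionOnto ∘L V.subtypeL : V →L[ℝ] W) : V →ₗ[ℝ] W).singularValues
      (Module.finrank ℝ V - 1))

/-- The image `Φ(n,0) V`. -/
def flow (A : ℕ → (Op d)ˣ) (n : ℕ) (V : Submodule ℝ (E d)) : Submodule ℝ (E d) :=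
  V.map ((Phi A n 0 : Op d) : E d →ₗ[ℝ] E d)

/-- The partial sum `a_{m,n}(V)` of the angles between `Φ(j-1,0) V` and `Φ(j,0) V` over
`m ≤ j ≤ n`, for `m ≥ 1`. -/
def a (A : ℕ → (Op d)ˣ) (m n : ℕ) (V : Submodule ℝ (E d)) : ℝ :=
  ∑ j ∈ Finset.Icc m n, ang (flow A (j - 1) V) (flow A j V)

/-- `(1/n) sup_k a_{k+1,k+n}(V)`. -/
def supMean (A : ℕ → (Op d)ˣ) (V : Submodule ℝ (E d)) (n : ℕ) : ℝ :=
  1 / (n : ℝ) * ⨆ k : ℕ, a A (k + 1) (k + n) V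

/-- `(1/n) inf_k a_{k+1,k+n}(V)`. -/
def infMean (A : ℕ → (Op d)ˣ) (V : Submodule ℝ (E d)) (n : ℕ) : ℝ :=
  1 / (n : ℝ) * ⨅ k : ℕ, a A (k + 1) (k + n) V

/-- `lim_n (1/n) sup_k a_{k+1,k+n}(V)`. -/
def upperRate (A : ℕ → (Op d)ˣ) (V : Submodule ℝ (E d)) : ℝ := limUnder atTop (supMean A V)

/-- `lim_n (1/n) inf_k a_{k+1,k+n}(V)`. -/
def lowerRate (A : ℕ → (Op d)ˣ) (V : Submodule ℝ (E d)) : ℝ := limUnder atTop (infMean A V)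

/-- The upper `s`-th uniform outer angular value. -/
def upperUniformOuter (A : ℕ → (Op d)ˣ) (s : ℕ) : ℝ := ⨆ V : grassmannian s d, upperRate A V

/-- The lower `s`-th uniform outer angular value. -/
def lowerUniformOuter (A : ℕ → (Op d)ˣ) (s : ℕ) : ℝ := ⨆ V : grassmannian s d, lowerRate A V

/-- `(1/n) sup_{V ∈ G(s,d)} sup_k a_{k+1,k+n}(V)`. -/
def innerMean (A : ℕ → (Op d)ˣ) (s n : ℕ) : ℝ :=
  1 / (n : ℝ) * ⨆ V : grassmannian s d, ⨆ k : ℕ, a A (k + 1) (k + n) (V : Submodule ℝ (E d))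

/-- The upper `s`-th uniform inner angular value. -/
def upperUniformInner (A : ℕ → (Op d)ˣ) (s : ℕ) : ℝ := limUnder atTop (innerMean A s)

/-- The supremum of `(1/n) a_{k+1,k+n}(v)` over all `k` and all nonzero `v ∈ V`, where
`a_{m,n}(v)` is `a_{m,n}` of the line spanned by `v`. It is `0` if `V` is the zero space. -/
def innerMeanOn (A : ℕ → (Op d)ˣ) (V : Submodule ℝ (E d)) (n : ℕ) : ℝ :=
  ⨆ v : {v : E d // v ∈ V ∧ v ≠ 0}, ⨆ k : ℕ, 1 / (n : ℝ) * a A (k + 1) (k + n) (ℝ ∙ (v : E d))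

/-- The first uniform inner angular value of the subspace `V` of initial vectors. -/
def innerOn (A : ℕ → (Op d)ˣ) (V : Submodule ℝ (E d)) : ℝ := limUnder atTop (innerMeanOn A V)

end AngVal

end

open Filter Topology

noncomputable section

namespace AngVal

variable {d : ℕ}

/-! ### The smallest singular value and the largest principal angle -/

/-! Existence of the limits is Fekete's lemma: sums over adjacent windows add up, so the suprema are
subadditive and the infima superadditive in the window length (`subadditive_windowSup`,
`tendsto_infMean`).

For the formulas, the dichotomies are condensed into projectors `Q i` at time `0` whose ranges are
the fibers and whose orbits stay uniformly separated, those in fiber `i` dominating those in fiber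
`j` geometrically for `i < j` (`IsDominatedSplitting`). On `ℕ` only the range of a dichotomy
projector is canonical: it is the set of vectors with orbit `O(γ ^ n)` (`growthLE_self_iff`). Since
the ranges are nested but the kernels are arbitrary, the projectors are multiplied along the chain;
the products have nested kernels as well, and their successive differences project onto the fibers
(`range_fiberProj`).

Outer values: filter `V` by its vectors without components of number `< i`, and take the leading
components. The sum of these graded pieces is a trace space of the same dimension, and domination
makes its image approach that of `V` geometrically (`exists_gap`). Angles between subspaces of equal
dimension satisfy the triangle inequality, so all window sums change by a bounded amount, which
disappears after division by `n` (`rates_eq`). Hence both suprema run over the same set of values.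

First inner value: two components of an orbit are of comparable size only at boundedly many times,
uniformly in the initial vector. At all other times one component dominates, and over a window of
fixed length the line follows a line of that fiber. Cutting a long window into short ones bounds its
sum by the suprema over the fibers, up to a small error per block and a bounded number of bad blocks
(`exists_a_window_mul_le`). -/

theorem norm_sq_apply_eq_sum {V W : Type*} [NormedAddCommGroup V] [InnerProductSpace ℝ V]
    [FiniteDimensional ℝ V] [NormedAddCommGroup W] [InnerProductSpace ℝ W]
    [FiniteDimensional ℝ W] (T : V →ₗ[ℝ] W) {n : ℕ} (hn : Module.finrank ℝ V = n) (v : V) :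
    ‖T v‖ ^ 2 = ∑ i, T.isSymmetric_adjoint_comp_self.eigenvalues hn i *
      ((T.isSymmetric_adjoint_comp_self.eigenvectorBasis hn).repr v i) ^ 2 := by
  set b := T.isSymmetric_adjoint_comp_self.eigenvectorBasis hn with hb
  have h1 : ‖T v‖ ^ 2 = inner ℝ v ((LinearMap.adjoint T ∘ₗ T) v) := by
    rw [LinearMap.comp_apply, LinearMap.adjoint_inner_right, real_inner_self_eq_norm_sq]
  rw [h1, ← b.repr.inner_map_map, PiLp.inner_apply]
  refine Finset.sum_congr rfl fun i _ => ?_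
  rw [hb, LinearMap.IsSymmetric.eigenvectorBasis_apply_self_apply]
  simp
  ring

/-- In an eigenbasis of `T* T` the quotient `‖T v‖ ^ 2 / ‖v‖ ^ 2` is an average of the eigenvalues,
and the last eigenvector attains the smallest one. -/
theorem le_singularValues_last_iff {V W : Type*} [NormedAddCommGroup V] [InnerProductSpace ℝ V]
    [FiniteDimensional ℝ V] [NormedAddCommGroup W] [InnerProductSpace ℝ W]
    [FiniteDimensional ℝ W] (T : V →ₗ[ℝ] W) (hV : 0 < Module.finrank ℝ V) {c : ℝ} (hc : 0 ≤ c) :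
    c ≤ T.singularValues (Module.finrank ℝ V - 1) ↔ ∀ v, c * ‖v‖ ≤ ‖T v‖ := by
  have hlt : Module.finrank ℝ V - 1 < Module.finrank ℝ V := by omega
  set b := T.isSymmetric_adjoint_comp_self.eigenvectorBasis rfl with hb
  have hsq := T.sq_singularValues_of_lt rfl hlt
  constructor
  · intro h v
    refine le_of_sq_le_sq ?_ (norm_nonneg _)
    rw [norm_sq_apply_eq_sum T rfl v, mul_pow, ← b.repr.norm_map, EuclideanSpace.real_norm_sq_eq,
      Finset.mul_sum]
    refine Finset.sum_le_sum fun i _ => mul_le_mul_of_nonneg_right ?_ (sq_nonneg _)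
    calc c ^ 2 ≤ T.singularValues (Module.finrank ℝ V - 1) ^ 2 := by gcongr
      _ = _ := hsq
      _ ≤ _ := T.isSymmetric_adjoint_comp_self.eigenvalues_antitone rfl (by
        rw [Fin.le_def]; have := i.2; simp only; omega)
  · intro h
    refine le_of_sq_le_sq ?_ (T.singularValues_nonneg _)
    have h1 := h (b ⟨_, hlt⟩)
    rw [b.norm_eq_one, mul_one] at h1
    rw [hsq]
    calc c ^ 2 ≤ ‖T (b ⟨_, hlt⟩)‖ ^ 2 := by gcongr
      _ = _ := by
        rw [norm_sq_apply_eq_sum T rfl]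
        simp [← hb]

theorem ang_nonneg (V W : Submodule ℝ (E d)) : 0 ≤ ang V W := Real.arccos_nonneg _

theorem ang_le_pi_div_two (V W : Submodule ℝ (E d)) : ang V W ≤ Real.pi / 2 :=
  Real.arccos_le_pi_div_two.2 (LinearMap.singularValues_nonneg _ _)

/-- Variational form of the angle, through which all later estimates go. The range of `θ` makes its
cosine nonnegative and `cos` monotone. -/
theorem ang_le_iff {V : Submodule ℝ (E d)} (W : Submodule ℝ (E d)) (hV : 0 < Module.finrank ℝ V)
    {θ : ℝ} (h0 : 0 ≤ θ) (h1 : θ ≤ Real.pi / 2) :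
    ang V W ≤ θ ↔ ∀ v ∈ V, Real.cos θ * ‖v‖ ≤ ‖W.orthogonalProjectionOnto v‖ := by
  have hpi := Real.pi_pos
  have hcos : 0 ≤ Real.cos θ := Real.cos_nonneg_of_neg_pi_div_two_le_of_le (by linarith) h1
  have key := le_singularValues_last_iff
    ((W.orthogonalProjectionOnto ∘L V.subtypeL : V →L[ℝ] W) : V →ₗ[ℝ] W) hV hcos
  have h2 : ang V W ≤ θ ↔ Real.cos θ ≤
      ((W.orthogonalProjectionOnto ∘L V.subtypeL : V →L[ℝ] W) : V →ₗ[ℝ] W).singularValues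
      (Module.finrank ℝ V - 1) := by
    have hnn := ((W.orthogonalProjectionOnto ∘L V.subtypeL : V →L[ℝ] W) :
      V →ₗ[ℝ] W).singularValues_nonneg (Module.finrank ℝ V - 1)
    unfold ang
    generalize ((W.orthogonalProjectionOnto ∘L V.subtypeL : V →L[ℝ] W) :
      V →ₗ[ℝ] W).singularValues (Module.finrank ℝ V - 1) = x at hnn
    constructor
    · intro h
      by_cases hx : 1 ≤ x
      · exact (Real.cos_le_one θ).trans hx
      · rw [← Real.cos_arccos (x := x) (by linarith) (by linarith)]
        exact Real.cos_le_cos_of_nonneg_of_le_pi (Real.arccos_nonneg _) (by linarith) h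
    · intro h
      rw [← Real.arccos_cos h0 (by linarith)]
      exact Real.arccos_le_arccos h
  rw [h2, key]
  simp

theorem cos_ang_mul_norm_le {V : Submodule ℝ (E d)} (W : Submodule ℝ (E d))
    (hV : 0 < Module.finrank ℝ V) {v : E d} (hv : v ∈ V) :
    Real.cos (ang V W) * ‖v‖ ≤ ‖W.orthogonalProjectionOnto v‖ :=
  (ang_le_iff W hV (ang_nonneg _ _) (ang_le_pi_div_two _ _)).1 le_rfl v hv

/-- If the angle is below `π / 2`, the projection `V → W` is injective, hence onto by equality of
dimensions. Writing `w` as the projection of `v` gives `‖w‖ ^ 2 = ⟪v, w⟫ ≤ ‖v‖ ‖proj_V w‖`, while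
`‖v‖` is controlled by `‖w‖`. -/
theorem ang_symm_le {V W : Submodule ℝ (E d)} (hV : 0 < Module.finrank ℝ V)
    (hVW : Module.finrank ℝ V = Module.finrank ℝ W) : ang W V ≤ ang V W := by
  rcases (ang_le_pi_div_two V W).eq_or_lt with h | h
  · exact h ▸ ang_le_pi_div_two W V
  rw [ang_le_iff V (hVW ▸ hV) (ang_nonneg _ _) (ang_le_pi_div_two _ _)]
  have hc : 0 < Real.cos (ang V W) := Real.cos_pos_of_mem_Ioo
    ⟨by linarith [ang_nonneg V W, Real.pi_pos], h⟩
  set T : V →ₗ[ℝ] W := ((W.orthogonalProjectionOnto ∘L V.subtypeL : V →L[ℝ] W) : V →ₗ[ℝ] W) with hT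
  have hTv : ∀ v : V, Real.cos (ang V W) * ‖v‖ ≤ ‖T v‖ := fun v =>
    cos_ang_mul_norm_le W hV v.2
  have hinj : Function.Injective T := by
    rw [injective_iff_map_eq_zero]
    intro v hv
    have := hTv v
    rw [hv, norm_zero] at this
    exact norm_eq_zero.1 (le_antisymm (nonpos_of_mul_nonpos_right this hc) (norm_nonneg _))
  have hsurj : Function.Surjective T :=
    (LinearMap.injective_iff_surjective_of_finrank_eq_finrank hVW).1 hinj
  intro w hw
  obtain ⟨v, hv⟩ := hsurj ⟨w, hw⟩
  rcases eq_or_ne w 0 with rfl | hw0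
  · simp
  have hwv : ‖T v‖ = ‖w‖ := by rw [hv]; rfl
  have h1 : ‖w‖ ^ 2 ≤ ‖v‖ * ‖V.orthogonalProjectionOnto w‖ := by
    have : ‖w‖ ^ 2 = inner ℝ v (V.orthogonalProjectionOnto w) := by
      rw [Submodule.inner_orthogonalProjectionOnto_eq_of_mem_left, ← real_inner_self_eq_norm_sq]
      have h3 : inner ℝ (⟨w, hw⟩ : W) (T v) = inner ℝ w w := by rw [hv]; rfl
      rw [← h3, hT]
      exact (Submodule.inner_orthogonalProjectionOnto_eq_of_mem_left (⟨w, hw⟩ : W) (v : E d)).trans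
        (real_inner_comm _ _)
    rw [this]
    exact real_inner_le_norm _ _
  have hw1 : 0 < ‖w‖ := norm_pos_iff.2 hw0
  have h2 := hTv v
  rw [hwv] at h2
  have h4 : ‖w‖ * (Real.cos (ang V W) * ‖w‖) ≤ ‖w‖ * ‖V.orthogonalProjectionOnto w‖ := by
    calc ‖w‖ * (Real.cos (ang V W) * ‖w‖) = Real.cos (ang V W) * ‖w‖ ^ 2 := by ring
      _ ≤ Real.cos (ang V W) * (‖v‖ * ‖V.orthogonalProjectionOnto w‖) := by gcongr
      _ = (Real.cos (ang V W) * ‖v‖) * ‖V.orthogonalProjectionOnto w‖ := by ring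
      _ ≤ _ := by gcongr
  exact le_of_mul_le_mul_left h4 hw1

theorem ang_comm {V W : Submodule ℝ (E d)} (hV : 0 < Module.finrank ℝ V)
    (hVW : Module.finrank ℝ V = Module.finrank ℝ W) : ang W V = ang V W :=
  le_antisymm (ang_symm_le hV hVW) (ang_symm_le (hVW ▸ hV) hVW.symm)

theorem angle_orthogonalProjectionOnto_le {V W : Submodule ℝ (E d)} (hV : 0 < Module.finrank ℝ V)
    {v : E d} (hv : v ∈ V) (hv0 : v ≠ 0) (hang : ang V W < Real.pi / 2) :
    (W.orthogonalProjectionOnto v : E d) ≠ 0 ∧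
      InnerProductGeometry.angle v (W.orthogonalProjectionOnto v) ≤ ang V W := by
  have hc : 0 < Real.cos (ang V W) := Real.cos_pos_of_mem_Ioo
    ⟨by linarith [ang_nonneg V W, Real.pi_pos], hang⟩
  have hv1 : 0 < ‖v‖ := norm_pos_iff.2 hv0
  have h1 := cos_ang_mul_norm_le W hV hv
  have hp : 0 < ‖(W.orthogonalProjectionOnto v : E d)‖ := lt_of_lt_of_le (mul_pos hc hv1) h1
  refine ⟨norm_pos_iff.1 hp, ?_⟩
  have hin : inner ℝ v (W.orthogonalProjectionOnto v : E d) =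
      ‖(W.orthogonalProjectionOnto v : E d)‖ ^ 2 := by
    rw [← real_inner_self_eq_norm_sq]
    exact (Submodule.inner_orthogonalProjectionOnto_eq_of_mem_right
      (W.orthogonalProjectionOnto v) v).symm.trans rfl |>.trans rfl
  rw [← Real.arccos_cos (ang_nonneg V W) (by linarith [Real.pi_pos])]
  unfold InnerProductGeometry.angle
  refine Real.arccos_le_arccos ?_
  rw [hin, le_div_iff₀ (by positivity)]
  calc Real.cos (ang V W) * (‖v‖ * ‖(W.orthogonalProjectionOnto v : E d)‖)
      = (Real.cos (ang V W) * ‖v‖) * ‖(W.orthogonalProjectionOnto v : E d)‖ := by ring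
    _ ≤ ‖(W.orthogonalProjectionOnto v : E d)‖ * ‖(W.orthogonalProjectionOnto v : E d)‖ := by
      gcongr; exact h1
    _ = _ := by ring

/-- Project `u` to `v ∈ V` and `v` to `w ∈ W`. The triangle inequality for angles of vectors bounds
the angle of `u` and `w`, and `⟪u, w⟫ ≤ ‖proj_W u‖ ‖w‖` turns this into a bound for the projection
of `u`. -/
theorem ang_triangle {U V W : Submodule ℝ (E d)} (hU : 0 < Module.finrank ℝ U)
    (hV : 0 < Module.finrank ℝ V) : ang U W ≤ ang U V + ang V W := by
  rcases le_or_gt (Real.pi / 2) (ang U V + ang V W) with h | h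
  · exact (ang_le_pi_div_two U W).trans h
  have hUV := ang_nonneg U V
  have hVW := ang_nonneg V W
  rw [ang_le_iff W hU (by positivity) h.le]
  intro u hu
  rcases eq_or_ne u 0 with rfl | hu0
  · simp
  obtain ⟨hv0, hv⟩ := angle_orthogonalProjectionOnto_le (W := V) hU hu hu0 (by linarith)
  obtain ⟨hw0, hw⟩ := angle_orthogonalProjectionOnto_le (W := W) hV
    (V.orthogonalProjectionOnto u).2 hv0 (by linarith)
  generalize ((V.orthogonalProjectionOnto u : V) : E d) = v at hv hw hv0 hw0
  generalize W.orthogonalProjectionOnto v = w at hw hw0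
  have h1 : InnerProductGeometry.angle u w ≤ ang U V + ang V W :=
    (InnerProductGeometry.angle_le_angle_add_angle u v w).trans (add_le_add hv hw)
  have h2 : Real.cos (ang U V + ang V W) ≤ Real.cos (InnerProductGeometry.angle u w) :=
    Real.cos_le_cos_of_nonneg_of_le_pi (InnerProductGeometry.angle_nonneg _ _)
      (by linarith [Real.pi_pos]) h1
  have hw1 : 0 < ‖(w : E d)‖ := norm_pos_iff.2 hw0
  have h3 : inner ℝ u (w : E d) ≤ ‖W.orthogonalProjectionOnto u‖ * ‖(w : E d)‖ := by
    rw [← Submodule.inner_orthogonalProjectionOnto_eq_of_mem_right w u]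
    exact real_inner_le_norm _ _
  rw [← InnerProductGeometry.cos_angle_mul_norm_mul_norm] at h3
  have h4 : Real.cos (ang U V + ang V W) * ‖u‖ * ‖(w : E d)‖ ≤
      ‖W.orthogonalProjectionOnto u‖ * ‖(w : E d)‖ := by
    refine le_trans ?_ h3
    rw [mul_assoc]
    gcongr
  exact le_of_mul_le_mul_right h4 hw1

theorem abs_ang_sub_ang_le {V W V' W' : Submodule ℝ (E d)} (hV : 0 < Module.finrank ℝ V)
    (hW : Module.finrank ℝ W = Module.finrank ℝ V) (hV' : Module.finrank ℝ V' = Module.finrank ℝ V)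
    (hW' : Module.finrank ℝ W' = Module.finrank ℝ V) :
    |ang V W - ang V' W'| ≤ ang V' V + ang W' W := by
  have h1 := ang_triangle (U := V) (V := V') (W := W) hV (hV' ▸ hV)
  have h2 := ang_triangle (U := V') (V := W') (W := W) (hV' ▸ hV) (hW' ▸ hV)
  have h3 := ang_triangle (U := V') (V := V) (W := W') (hV' ▸ hV) hV
  have h4 := ang_triangle (U := V) (V := W) (W := W') hV (hW ▸ hV)
  rw [ang_comm (V := V') (W := V) (hV' ▸ hV) hV'] at h1
  rw [ang_comm (V := W') (W := W) (hW' ▸ hV) (hW'.trans hW.symm)] at h4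
  rw [abs_le]
  constructor <;> linarith

/-- The gap bounds the sine of the angle; Jordan's inequality `2 x / π ≤ sin x` makes the bound
linear. -/
theorem ang_le_of_gap {V W : Submodule ℝ (E d)} (hV : 0 < Module.finrank ℝ V) {δ : ℝ}
    (hδ : 0 ≤ δ) (h : ∀ v ∈ V, ∃ w ∈ W, ‖v - w‖ ≤ δ * ‖v‖) : ang V W ≤ Real.pi / 2 * δ := by
  have hpi := Real.pi_pos
  rcases le_or_gt 1 δ with h1 | h1
  · exact (ang_le_pi_div_two V W).trans (le_mul_of_one_le_right (by positivity) h1)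
  have h2 : Real.pi / 2 * δ ≤ Real.pi / 2 := mul_le_of_le_one_right (by positivity) h1.le
  rw [ang_le_iff W hV (by positivity) h2]
  intro v hv
  have hsin : δ ≤ Real.sin (Real.pi / 2 * δ) := by
    have := Real.mul_le_sin (x := Real.pi / 2 * δ) (by positivity) h2
    calc δ = 2 / Real.pi * (Real.pi / 2 * δ) := by field_simp
      _ ≤ _ := this
  obtain ⟨w, hw, hvw⟩ := h v hv
  have h3 : ‖v - W.orthogonalProjectionOnto v‖ ≤ ‖v - w‖ := by
    have := W.starProjection_minimal v
    have h4 := ciInf_le (f := fun x : W => ‖v - x‖) ⟨0, by rintro _ ⟨x, rfl⟩; positivity⟩ ⟨w, hw⟩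
    rw [← this] at h4
    exact h4
  have h5 : ‖v‖ ^ 2 = ‖W.orthogonalProjectionOnto v‖ ^ 2 + ‖v - W.orthogonalProjectionOnto v‖ ^ 2 := by
    have := norm_add_sq_eq_norm_sq_add_norm_sq_real
      (x := (W.orthogonalProjectionOnto v : E d)) (y := v - W.orthogonalProjectionOnto v) (by
        rw [inner_sub_right, sub_eq_zero]
        exact (Submodule.inner_orthogonalProjectionOnto_eq_of_mem_left
          (W.orthogonalProjectionOnto v) v).symm.trans rfl)
    rw [add_sub_cancel] at this
    simpa [sq] using this
  have h6 : ‖v - W.orthogonalProjectionOnto v‖ ≤ Real.sin (Real.pi / 2 * δ) * ‖v‖ :=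
    h3.trans (hvw.trans (by gcongr))
  refine le_of_sq_le_sq ?_ (norm_nonneg _)
  have h7 : ‖v - W.orthogonalProjectionOnto v‖ ^ 2 ≤ (Real.sin (Real.pi / 2 * δ) * ‖v‖) ^ 2 := by
    gcongr
  have h8 := Real.sin_sq_add_cos_sq (Real.pi / 2 * δ)
  rw [mul_pow] at h7 ⊢
  nlinarith [sq_nonneg ‖v‖]

/-! ### Sums over windows and the existence of the limits -/

theorem a_window_eq (A : ℕ → (Op d)ˣ) (V : Submodule ℝ (E d)) (k n : ℕ) :
    a A (k + 1) (k + n) V =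
      ∑ j ∈ Finset.range n, ang (flow A (k + j) V) (flow A (k + j + 1) V) := by
  unfold a
  induction n with
  | zero => simp
  | succ n ih =>
    rw [Finset.sum_range_succ, ← ih, ← add_assoc, Finset.sum_Icc_succ_top (by omega)]
    simp

theorem a_window_add (A : ℕ → (Op d)ˣ) (V : Submodule ℝ (E d)) (k m n : ℕ) :
    a A (k + 1) (k + (m + n)) V = a A (k + 1) (k + m) V + a A (k + m + 1) (k + m + n) V := by
  rw [a_window_eq, a_window_eq, a_window_eq, Finset.sum_range_add]
  simp only [add_assoc]

theorem a_window_nonneg (A : ℕ → (Op d)ˣ) (V : Submodule ℝ (E d)) (k n : ℕ) :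
    0 ≤ a A (k + 1) (k + n) V :=
  Finset.sum_nonneg fun _ _ => ang_nonneg _ _

theorem a_window_le (A : ℕ → (Op d)ˣ) (V : Submodule ℝ (E d)) (k n : ℕ) :
    a A (k + 1) (k + n) V ≤ n * (Real.pi / 2) := by
  rw [a_window_eq]
  calc _ ≤ ∑ _j ∈ Finset.range n, Real.pi / 2 :=
        Finset.sum_le_sum fun _ _ => ang_le_pi_div_two _ _
    _ = _ := by simp

theorem bddAbove_range_a_window (A : ℕ → (Op d)ˣ) (V : Submodule ℝ (E d)) (n : ℕ) :
    BddAbove (Set.range fun k => a A (k + 1) (k + n) V) :=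
  ⟨_, by rintro _ ⟨k, rfl⟩; exact a_window_le A V k n⟩

theorem bddBelow_range_a_window (A : ℕ → (Op d)ˣ) (V : Submodule ℝ (E d)) (n : ℕ) :
    BddBelow (Set.range fun k => a A (k + 1) (k + n) V) :=
  ⟨0, by rintro _ ⟨k, rfl⟩; exact a_window_nonneg A V k n⟩

/-- The supremum of the sums of `n` consecutive angles over all windows and a family of
subspaces. -/
def windowSup {ι : Sort*} (A : ℕ → (Op d)ˣ) (V : ι → Submodule ℝ (E d)) (n : ℕ) : ℝ :=
  ⨆ x, ⨆ k : ℕ, a A (k + 1) (k + n) (V x)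

section windowSup

variable {ι : Sort*} (A : ℕ → (Op d)ˣ) (V : ι → Submodule ℝ (E d))

theorem windowSup_nonneg (n : ℕ) : 0 ≤ windowSup A V n :=
  Real.iSup_nonneg fun _ => Real.iSup_nonneg fun _ => a_window_nonneg _ _ _ _

/-- The bound `0 ≤ c` takes care of an empty family, such as the nonzero vectors of a zero fiber,
whose real supremum is `0`. -/
theorem windowSup_le {n : ℕ} {c : ℝ} (hc : 0 ≤ c) (h : ∀ x k, a A (k + 1) (k + n) (V x) ≤ c) :
    windowSup A V n ≤ c :=
  Real.iSup_le (fun x => Real.iSup_le (fun k => h x k) hc) hc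

theorem le_windowSup (x : ι) (k n : ℕ) : a A (k + 1) (k + n) (V x) ≤ windowSup A V n := by
  refine (le_ciSup (bddAbove_range_a_window A (V x) n) k).trans ?_
  refine le_ciSup (f := fun x => ⨆ k : ℕ, a A (k + 1) (k + n) (V x)) ⟨n * (Real.pi / 2), ?_⟩ x
  rintro _ ⟨y, rfl⟩
  exact ciSup_le fun k => a_window_le A (V y) k n

theorem subadditive_windowSup : Subadditive (windowSup A V) := fun m n =>
  windowSup_le A V (add_nonneg (windowSup_nonneg A V m) (windowSup_nonneg A V n)) fun x k => by
    rw [a_window_add]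
    exact add_le_add (le_windowSup A V x k m) (le_windowSup A V x (k + m) n)

theorem exists_tendsto_windowSup :
    ∃ L, Tendsto (fun n : ℕ => 1 / (n : ℝ) * windowSup A V n) atTop (𝓝 L) := by
  refine ⟨_, ((subadditive_windowSup A V).tendsto_lim ⟨0, ?_⟩).congr fun n => ?_⟩
  · rintro _ ⟨n, rfl⟩
    exact div_nonneg (windowSup_nonneg A V n) (Nat.cast_nonneg n)
  · ring

end windowSup

theorem supMean_eq (A : ℕ → (Op d)ˣ) (V : Submodule ℝ (E d)) (n : ℕ) :
    supMean A V n = 1 / (n : ℝ) * windowSup A (fun _ : Unit => V) n := by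
  simp [supMean, windowSup]

theorem innerMean_eq (A : ℕ → (Op d)ˣ) (s n : ℕ) :
    innerMean A s n =
      1 / (n : ℝ) * windowSup A (fun V : grassmannian s d => (V : Submodule ℝ (E d))) n :=
  rfl

theorem innerMeanOn_eq (A : ℕ → (Op d)ˣ) (V : Submodule ℝ (E d)) (n : ℕ) :
    innerMeanOn A V n =
      1 / (n : ℝ) * windowSup A (fun v : {v : E d // v ∈ V ∧ v ≠ 0} => ℝ ∙ (v : E d)) n := by
  simp only [innerMeanOn, windowSup, Real.mul_iSup_of_nonneg (show 0 ≤ 1 / (n : ℝ) by positivity)]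

theorem tendsto_supMean (A : ℕ → (Op d)ˣ) (V : Submodule ℝ (E d)) :
    Tendsto (supMean A V) atTop (𝓝 (upperRate A V)) := by
  refine tendsto_nhds_limUnder ?_
  rw [funext (supMean_eq A V)]
  exact exists_tendsto_windowSup A _

theorem tendsto_innerMean (A : ℕ → (Op d)ˣ) (s : ℕ) :
    Tendsto (innerMean A s) atTop (𝓝 (upperUniformInner A s)) := by
  refine tendsto_nhds_limUnder ?_
  rw [funext (innerMean_eq A s)]
  exact exists_tendsto_windowSup A _

theorem tendsto_innerMeanOn (A : ℕ → (Op d)ˣ) (V : Submodule ℝ (E d)) :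
    Tendsto (innerMeanOn A V) atTop (𝓝 (innerOn A V)) := by
  refine tendsto_nhds_limUnder ?_
  rw [funext (innerMeanOn_eq A V)]
  exact exists_tendsto_windowSup A _

theorem tendsto_infMean (A : ℕ → (Op d)ˣ) (V : Submodule ℝ (E d)) :
    Tendsto (infMean A V) atTop (𝓝 (lowerRate A V)) := by
  refine tendsto_nhds_limUnder ?_
  have hsub : Subadditive fun n => -⨅ k : ℕ, a A (k + 1) (k + n) V := fun m n => by
    rw [← neg_add, neg_le_neg_iff]
    refine le_ciInf fun k => ?_
    rw [a_window_add]
    exact add_le_add (ciInf_le (bddBelow_range_a_window A V m) k)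
      (ciInf_le (bddBelow_range_a_window A V n) (k + m))
  have hbdd : BddBelow (Set.range fun n : ℕ => (-⨅ k : ℕ, a A (k + 1) (k + n) V) / n) := by
    refine ⟨-(Real.pi / 2), ?_⟩
    rintro _ ⟨n, rfl⟩
    simp only [neg_div, neg_le_neg_iff]
    have hpi := Real.pi_pos
    refine div_le_of_le_mul₀ (Nat.cast_nonneg n) (by positivity) ?_
    rw [mul_comm]
    exact (ciInf_le (bddBelow_range_a_window A V n) 0).trans (a_window_le A V 0 n)
  refine ⟨_, (hsub.tendsto_lim hbdd).neg.congr fun n => ?_⟩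
  rw [infMean]
  ring

theorem supMean_le (A : ℕ → (Op d)ˣ) (V : Submodule ℝ (E d)) (n : ℕ) :
    supMean A V n ≤ Real.pi / 2 := by
  have hpi := Real.pi_pos
  rcases n.eq_zero_or_pos with rfl | hn
  · simp [supMean]; positivity
  · rw [supMean, one_div, inv_mul_le_iff₀ (by positivity)]
    exact ciSup_le fun k => a_window_le A V k n

theorem infMean_le_supMean (A : ℕ → (Op d)ˣ) (V : Submodule ℝ (E d)) (n : ℕ) :
    infMean A V n ≤ supMean A V n := by
  unfold infMean supMean
  gcongr
  exact (ciInf_le (bddBelow_range_a_window A V n) 0).trans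
    (le_ciSup (bddAbove_range_a_window A V n) 0)

theorem upperRate_le (A : ℕ → (Op d)ˣ) (V : Submodule ℝ (E d)) : upperRate A V ≤ Real.pi / 2 :=
  le_of_tendsto' (tendsto_supMean A V) (supMean_le A V)

theorem lowerRate_le (A : ℕ → (Op d)ˣ) (V : Submodule ℝ (E d)) : lowerRate A V ≤ Real.pi / 2 :=
  le_of_tendsto' (tendsto_infMean A V) fun n =>
    (infMean_le_supMean A V n).trans (supMean_le A V n)

theorem tendsto_one_div_mul_const (D : ℝ) :
    Tendsto (fun n : ℕ => 1 / (n : ℝ) * D) atTop (𝓝 0) := by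
  simpa using tendsto_one_div_atTop_nhds_zero_nat.mul_const D

/-- The rates of two subspaces agree if their window sums differ by a bounded amount. -/
theorem rates_eq_of_abs_sub_le {A : ℕ → (Op d)ˣ} {V W : Submodule ℝ (E d)} {D : ℝ}
    (h : ∀ k n, |a A (k + 1) (k + n) V - a A (k + 1) (k + n) W| ≤ D) :
    upperRate A V = upperRate A W ∧ lowerRate A V = lowerRate A W := by
  have aux : ∀ V W : Submodule ℝ (E d),
      (∀ k n, |a A (k + 1) (k + n) V - a A (k + 1) (k + n) W| ≤ D) →
      upperRate A V ≤ upperRate A W ∧ lowerRate A V ≤ lowerRate A W := by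
    intro V W h
    constructor
    · have h1 := (tendsto_supMean A W).add (tendsto_one_div_mul_const D)
      rw [add_zero] at h1
      refine le_of_tendsto_of_tendsto' (tendsto_supMean A V) h1 fun n => ?_
      unfold supMean
      rw [← mul_add]
      gcongr
      refine ciSup_le fun k => ?_
      linarith [(abs_le.1 (h k n)).2, le_ciSup (bddAbove_range_a_window A W n) k]
    · have h1 := (tendsto_infMean A W).add (tendsto_one_div_mul_const D)
      rw [add_zero] at h1
      refine le_of_tendsto_of_tendsto' (tendsto_infMean A V) h1 fun n => ?_
      unfold infMean
      rw [← mul_add]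
      gcongr
      rw [← sub_le_iff_le_add]
      refine le_ciInf fun k => ?_
      linarith [(abs_le.1 (h k n)).2, ciInf_le (bddBelow_range_a_window A V n) k]
  have h' : ∀ k n, |a A (k + 1) (k + n) W - a A (k + 1) (k + n) V| ≤ D := fun k n => by
    rw [abs_sub_comm]; exact h k n
  exact ⟨le_antisymm (aux V W h).1 (aux W V h').1, le_antisymm (aux V W h).2 (aux W V h').2⟩

/-! ### Subspaces with asymptotic images -/

theorem finrank_flow (A : ℕ → (Op d)ˣ) (n : ℕ) (V : Submodule ℝ (E d)) :
    Module.finrank ℝ (flow A n V) = Module.finrank ℝ V := by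
  refine (Submodule.equivMapOfInjective _ (Function.LeftInverse.injective
    (g := (((Phi A n 0)⁻¹ : (Op d)ˣ) : Op d)) fun x => ?_) V).finrank_eq.symm
  change ((((Phi A n 0)⁻¹ : (Op d)ˣ) : Op d) * (Phi A n 0 : Op d)) x = x
  simp

/-- If the images of `W` approach those of `V` at a geometric rate, then `V` and `W` have the same
rates. -/
theorem rates_eq_of_gap {A : ℕ → (Op d)ˣ} {V W : Submodule ℝ (E d)}
    (hV : 0 < Module.finrank ℝ V) (hW : Module.finrank ℝ W = Module.finrank ℝ V) {C ρ : ℝ}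
    (hC : 0 ≤ C) (hρ0 : 0 ≤ ρ) (hρ1 : ρ < 1)
    (h : ∀ n, ∀ w ∈ flow A n W, ∃ v ∈ flow A n V, ‖w - v‖ ≤ C * ρ ^ n * ‖w‖) :
    upperRate A V = upperRate A W ∧ lowerRate A V = lowerRate A W := by
  have hpi := Real.pi_pos
  have hang : ∀ n, ang (flow A n W) (flow A n V) ≤ Real.pi / 2 * C * ρ ^ n := fun n => by
    rw [mul_assoc]
    exact ang_le_of_gap (by rw [finrank_flow, hW]; exact hV) (by positivity) (h n)
  -- Each angle changes by at most the sum of the gaps at its two ends. Starting the window at `k`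
  -- only improves the geometric factor, so the bound is uniform in `k`.
  refine rates_eq_of_abs_sub_le (D := Real.pi * C * (1 - ρ)⁻¹) fun k n => ?_
  rw [a_window_eq, a_window_eq, ← Finset.sum_sub_distrib]
  refine (Finset.abs_sum_le_sum_abs _ _).trans ?_
  calc _ ≤ ∑ j ∈ Finset.range n, Real.pi * C * ρ ^ j := by
        refine Finset.sum_le_sum fun j _ => ?_
        refine (abs_ang_sub_ang_le (by rwa [finrank_flow]) (by simp only [finrank_flow])
          (by simp only [finrank_flow, hW]) (by simp only [finrank_flow, hW])).trans ?_
        have e1 : ρ ^ (k + j) ≤ ρ ^ j := pow_le_pow_of_le_one hρ0 hρ1.le (by omega)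
        have e2 : ρ ^ (k + j + 1) ≤ ρ ^ j := pow_le_pow_of_le_one hρ0 hρ1.le (by omega)
        calc _ ≤ Real.pi / 2 * C * ρ ^ (k + j) + Real.pi / 2 * C * ρ ^ (k + j + 1) :=
              add_le_add (hang _) (hang _)
          _ ≤ Real.pi / 2 * C * ρ ^ j + Real.pi / 2 * C * ρ ^ j := by gcongr
          _ = _ := by ring
    _ = Real.pi * C * ∑ j ∈ Finset.range n, ρ ^ j := by rw [Finset.mul_sum]
    _ ≤ _ := by
      gcongr
      rw [← tsum_geometric_of_lt_one hρ0 hρ1]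
      exact (summable_geometric_of_lt_one hρ0 hρ1).sum_le_tsum _ fun _ _ => by positivity

/-! ### Dominated splittings and the reduction to trace spaces -/

/-- The projectors `Q i` decompose the space at time `0` into subspaces whose orbits are uniformly
separated, and the orbits in the `i`-th subspace dominate those in the `j`-th one for `i < j`. -/
structure IsDominatedSplitting (A : ℕ → (Op d)ˣ) {ℓ : ℕ} (Q : Fin ℓ → Op d) (M K ρ : ℝ) :
    Prop where
  M_nonneg : 0 ≤ M
  K_nonneg : 0 ≤ K
  ρ_nonneg : 0 ≤ ρ
  ρ_lt_one : ρ < 1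
  sum_eq : ∑ i, Q i = 1
  mul_self : ∀ i, Q i * Q i = Q i
  mul_eq_zero : ∀ i j, i ≠ j → Q i * Q j = 0
  norm_le : ∀ i n x, ‖(Phi A n 0 : Op d) (Q i x)‖ ≤ M * ‖(Phi A n 0 : Op d) x‖
  dominated : ∀ i j, i < j → ∀ m n, m ≤ n → ∀ x y,
    ‖(Phi A n 0 : Op d) (Q j x)‖ * ‖(Phi A m 0 : Op d) (Q i y)‖ ≤
      K * ρ ^ (n - m) * (‖(Phi A m 0 : Op d) (Q j x)‖ * ‖(Phi A n 0 : Op d) (Q i y)‖)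

namespace IsDominatedSplitting

variable {A : ℕ → (Op d)ˣ} {ℓ : ℕ} {Q : Fin ℓ → Op d} {M K ρ : ℝ}

theorem sum_apply (h : IsDominatedSplitting A Q M K ρ) (x : E d) : ∑ i, Q i x = x := by
  have := congrArg (fun T : Op d => T x) h.sum_eq
  simpa using this

theorem apply_self (h : IsDominatedSplitting A Q M K ρ) (i : Fin ℓ) (x : E d) :
    Q i (Q i x) = Q i x :=
  congrArg (fun T : Op d => T x) (h.mul_self i)

theorem apply_ne (h : IsDominatedSplitting A Q M K ρ) {i j : Fin ℓ} (hij : i ≠ j) (x : E d) :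
    Q i (Q j x) = 0 :=
  congrArg (fun T : Op d => T x) (h.mul_eq_zero i j hij)

theorem norm_apply_le (h : IsDominatedSplitting A Q M K ρ) (i : Fin ℓ) (x : E d) :
    ‖Q i x‖ ≤ M * ‖x‖ := by
  simpa [Phi_self] using h.norm_le i 0 x

/-- The flag of subspaces of the initial vectors without components of number `< k`. -/
def flag (Q : Fin ℓ → Op d) (k : ℕ) : Submodule ℝ (E d) :=
  ⨅ j : Fin ℓ, ⨅ _ : (j : ℕ) < k, (Q j : E d →ₗ[ℝ] E d).ker

theorem mem_flag {k : ℕ} {x : E d} : x ∈ flag Q k ↔ ∀ j : Fin ℓ, (j : ℕ) < k → Q j x = 0 := by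
  simp [flag, Submodule.mem_iInf]

/-- The `i`-th graded piece of a subspace `V`, as a subspace of the range of `Q i`. -/
def gradedPiece (Q : Fin ℓ → Op d) (V : Submodule ℝ (E d)) (i : Fin ℓ) : Submodule ℝ (E d) :=
  (V ⊓ flag Q i).map (Q i : E d →ₗ[ℝ] E d)

theorem gradedPiece_le (Q : Fin ℓ → Op d) (V : Submodule ℝ (E d)) (i : Fin ℓ) :
    gradedPiece Q V i ≤ (Q i : E d →ₗ[ℝ] E d).range :=
  LinearMap.map_le_range

/-- Rank-nullity for `Q i` on the `i`-th step of the filtration of `V`: the kernel is the next step.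
-/
theorem finrank_gradedPiece_add (Q : Fin ℓ → Op d) (V : Submodule ℝ (E d)) (i : Fin ℓ) :
    Module.finrank ℝ (gradedPiece Q V i) + Module.finrank ℝ (V ⊓ flag Q (i + 1) : Submodule ℝ (E d))
      = Module.finrank ℝ (V ⊓ flag Q i : Submodule ℝ (E d)) := by
  set U := V ⊓ flag Q i
  set T : U →ₗ[ℝ] E d := (Q i : E d →ₗ[ℝ] E d).domRestrict U with hT
  have h1 := T.finrank_range_add_finrank_ker
  have h2 : T.range = gradedPiece Q V i := by
    rw [hT, LinearMap.range_domRestrict]; rfl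
  have h3 : T.ker.map U.subtype = V ⊓ flag Q (i + 1) := by
    ext x
    simp only [Submodule.mem_map, LinearMap.mem_ker, Submodule.subtype_apply, Subtype.exists,
      Submodule.mem_inf, mem_flag]
    constructor
    · rintro ⟨y, ⟨hyV, hyF⟩, hy, rfl⟩
      refine ⟨hyV, fun j hj => ?_⟩
      rcases Nat.lt_succ_iff_lt_or_eq.1 hj with hj | hj
      · exact mem_flag.1 hyF j hj
      · rw [Fin.ext hj]; exact hy
    · rintro ⟨hV, hF⟩
      exact ⟨x, ⟨hV, mem_flag.2 fun j hj => hF j (by omega)⟩, hF i (by omega), rfl⟩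
  rw [← h1, h2, ← h3, (Submodule.equivMapOfInjective U.subtype U.injective_subtype T.ker).finrank_eq]

theorem sum_finrank_gradedPiece (h : IsDominatedSplitting A Q M K ρ) (V : Submodule ℝ (E d)) :
    ∑ i, Module.finrank ℝ (gradedPiece Q V i) = Module.finrank ℝ V := by
  set f : ℕ → ℤ := fun k => Module.finrank ℝ (V ⊓ flag Q k : Submodule ℝ (E d)) with hf
  have h0 : f 0 = Module.finrank ℝ V := by
    have : V ⊓ flag Q 0 = V := inf_eq_left.2 fun x _ => mem_flag.2 fun j hj => absurd hj (by omega)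
    change ((Module.finrank ℝ (V ⊓ flag Q 0 : Submodule ℝ (E d)) : ℕ) : ℤ) = _
    rw [this]
  have hl : f ℓ = 0 := by
    have : V ⊓ flag Q ℓ = ⊥ := by
      rw [eq_bot_iff]
      rintro x ⟨-, hx⟩
      rw [Submodule.mem_bot, ← h.sum_apply x]
      exact Finset.sum_eq_zero fun j _ => mem_flag.1 hx j j.2
    change ((Module.finrank ℝ (V ⊓ flag Q ℓ : Submodule ℝ (E d)) : ℕ) : ℤ) = _
    rw [this]
    simp
  zify
  calc ∑ i, (Module.finrank ℝ (gradedPiece Q V i) : ℤ) = ∑ i : Fin ℓ, (f i - f (i + 1)) := by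
        refine Finset.sum_congr rfl fun i _ => ?_
        have := finrank_gradedPiece_add Q V i
        simp only [hf]
        omega
    _ = ∑ k ∈ Finset.range ℓ, (f k - f (k + 1)) :=
        Fin.sum_univ_eq_sum_range (fun k => f k - f (k + 1)) ℓ
    _ = _ := by rw [Finset.sum_range_sub', h0, hl, sub_zero]

theorem eq_apply_of_mem_range (h : IsDominatedSplitting A Q M K ρ) {i : Fin ℓ} {x : E d}
    (hx : x ∈ (Q i : E d →ₗ[ℝ] E d).range) : Q i x = x := by
  obtain ⟨y, rfl⟩ := hx
  exact h.apply_self i y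

theorem apply_eq_zero_of_mem_range (h : IsDominatedSplitting A Q M K ρ) {i j : Fin ℓ}
    (hij : i ≠ j) {x : E d} (hx : x ∈ (Q j : E d →ₗ[ℝ] E d).range) : Q i x = 0 := by
  obtain ⟨y, rfl⟩ := hx
  exact h.apply_ne hij y

theorem iSupIndep_of_le_range (h : IsDominatedSplitting A Q M K ρ)
    {W : Fin ℓ → Submodule ℝ (E d)} (hW : ∀ i, W i ≤ (Q i : E d →ₗ[ℝ] E d).range) :
    iSupIndep W := by
  intro i
  rw [Submodule.disjoint_def]
  intro x hx hx'
  have h1 : (⨆ j, ⨆ _ : j ≠ i, W j) ≤ (Q i : E d →ₗ[ℝ] E d).ker :=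
    iSup₂_le fun j hj y hy => h.apply_eq_zero_of_mem_range hj.symm (hW j hy)
  rw [← h.eq_apply_of_mem_range (hW i hx)]
  exact h1 hx'

theorem apply_mem_gradedPiece (h : IsDominatedSplitting A Q M K ρ) {V : Submodule ℝ (E d)}
    {x : E d} (hx : x ∈ ⨆ i, gradedPiece Q V i) (i : Fin ℓ) : Q i x ∈ gradedPiece Q V i := by
  have h1 : (⨆ i, gradedPiece Q V i) ≤ (gradedPiece Q V i).comap (Q i : E d →ₗ[ℝ] E d) := by
    refine iSup_le fun j y hy => ?_
    rw [Submodule.mem_comap]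
    rcases eq_or_ne i j with rfl | hij
    · change Q i y ∈ _
      rwa [h.eq_apply_of_mem_range (gradedPiece_le Q V i hy)]
    · change Q i y ∈ _
      rw [h.apply_eq_zero_of_mem_range hij (gradedPiece_le Q V j hy)]
      exact zero_mem _
  exact h1 hx

/-- The components `Q i x` identify the sum with the product of the pieces, whose dimensions
telescope to that of `V`. -/
theorem finrank_iSup_gradedPiece (h : IsDominatedSplitting A Q M K ρ) (V : Submodule ℝ (E d)) :
    Module.finrank ℝ (⨆ i, gradedPiece Q V i : Submodule ℝ (E d)) = Module.finrank ℝ V := by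
  rw [← h.sum_finrank_gradedPiece V, ← Module.finrank_pi_fintype ℝ]
  let f : (⨆ i, gradedPiece Q V i : Submodule ℝ (E d)) →ₗ[ℝ] ∀ i, gradedPiece Q V i :=
    LinearMap.pi fun i => ((Q i : E d →ₗ[ℝ] E d).domRestrict _).codRestrict (gradedPiece Q V i)
      fun x => h.apply_mem_gradedPiece x.2 i
  have hf : ∀ x i, ((f x i : gradedPiece Q V i) : E d) = Q i x := fun x i => rfl
  refine (LinearEquiv.ofBijective f ⟨?_, fun w => ?_⟩).finrank_eq
  · rw [injective_iff_map_eq_zero]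
    intro x hx
    refine Subtype.ext ?_
    rw [← h.sum_apply (x : E d)]
    refine Finset.sum_eq_zero fun i _ => ?_
    rw [← hf, hx]
    rfl
  · refine ⟨⟨∑ i, (w i : E d), Submodule.sum_mem _ fun i _ =>
      Submodule.mem_iSup_of_mem i (w i).2⟩, ?_⟩
    ext1 i
    refine Subtype.ext ?_
    rw [hf]
    change Q i (∑ i, (w i : E d)) = _
    rw [map_sum, Finset.sum_eq_single i]
    · exact h.eq_apply_of_mem_range (gradedPiece_le Q V i (w i).2)
    · exact fun j _ hj =>
        h.apply_eq_zero_of_mem_range hj.symm (gradedPiece_le Q V j (w j).2)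
    · simp

/-- A linear right inverse of a surjection in finite dimension is bounded. -/
theorem exists_bounded_lift (Q : Fin ℓ → Op d) (V : Submodule ℝ (E d)) (i : Fin ℓ) :
    ∃ C : ℝ, 0 ≤ C ∧ ∀ w ∈ gradedPiece Q V i, ∃ u ∈ V ⊓ flag Q i, Q i u = w ∧ ‖u‖ ≤ C * ‖w‖ := by
  set U := V ⊓ flag Q i
  set T : U →ₗ[ℝ] gradedPiece Q V i := (Q i : E d →ₗ[ℝ] E d).submoduleMap U with hT
  obtain ⟨S, hS⟩ := T.exists_rightInverse_of_surjective
    (LinearMap.range_eq_top.2 (LinearMap.submoduleMap_surjective _ U))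
  refine ⟨‖S.toContinuousLinearMap‖, S.toContinuousLinearMap.opNorm_nonneg, fun w hw => ⟨S ⟨w, hw⟩, (S ⟨w, hw⟩).2, ?_, ?_⟩⟩
  · have := congrArg (fun f => ((f ⟨w, hw⟩ : gradedPiece Q V i) : E d)) hS
    exact this
  · exact S.toContinuousLinearMap.le_opNorm ⟨w, hw⟩

/-- Lift each component `Q i x` to `u i ∈ V` with leading component `Q i x`. Then `∑ i, u i` differs
from `x` only by the components `Q j (u i)` with `i < j`, which are dominated by the orbit of `Q i
x` and hence by that of `x`. -/
theorem exists_gap (h : IsDominatedSplitting A Q M K ρ) (V : Submodule ℝ (E d)) :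
    ∃ C : ℝ, 0 ≤ C ∧ ∀ n, ∀ w ∈ flow A n (⨆ i, gradedPiece Q V i), ∃ v ∈ flow A n V,
      ‖w - v‖ ≤ C * ρ ^ n * ‖w‖ := by
  have hM := h.M_nonneg
  have hK := h.K_nonneg
  have hρ := h.ρ_nonneg
  choose C hC0 hC using exists_bounded_lift Q V
  refine ⟨∑ i, ∑ _j : Fin ℓ, K * (M * C i) * M,
    Finset.sum_nonneg fun i _ => Finset.sum_nonneg fun _ _ => by have := hC0 i; positivity, ?_⟩
  rintro n _ ⟨x, hx, rfl⟩
  choose u hu hQu hnu using fun i => hC i (Q i x) (h.apply_mem_gradedPiece hx i)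
  refine ⟨(Phi A n 0 : Op d) (∑ i, u i),
    ⟨_, Submodule.sum_mem _ fun i _ => (hu i).1, rfl⟩, ?_⟩
  change ‖(Phi A n 0 : Op d) x - _‖ ≤ _ * ‖(Phi A n 0 : Op d) x‖
  have hterm : ∀ i j, i < j → ‖(Phi A n 0 : Op d) (Q j (u i))‖ ≤
      K * (M * C i) * M * ρ ^ n * ‖(Phi A n 0 : Op d) x‖ := by
    intro i j hij
    -- Domination is in product form, so `‖Q i x‖` has to be cancelled; if it vanishes, the bounded
    -- lift vanishes too.
    rcases eq_or_ne (Q i x) 0 with h0 | h0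
    · have : u i = 0 := by
        have := hnu i
        rw [h0, norm_zero, mul_zero] at this
        exact norm_le_zero_iff.1 this
      rw [this]
      simp only [map_zero, norm_zero]
      have := hC0 i
      positivity
    · have h1 := h.dominated i j hij 0 n (Nat.zero_le n) (u i) x
      simp only [Phi_self, Nat.sub_zero, Units.val_one, one_apply_eq_self] at h1
      refine le_of_mul_le_mul_right (h1.trans ?_) (norm_pos_iff.2 h0)
      have h2 : ‖Q j (u i)‖ ≤ M * (C i * ‖Q i x‖) :=
        (h.norm_apply_le j (u i)).trans (by gcongr; exact hnu i)
      calc _ ≤ K * ρ ^ n * ((M * (C i * ‖Q i x‖)) * (M * ‖(Phi A n 0 : Op d) x‖)) := by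
            have := hC0 i
            gcongr
            exact h.norm_le i n x
        _ = _ := by ring
  have hdiff : x - ∑ i, u i = -∑ i, ∑ j ∈ Finset.univ.filter (fun j => i < j), Q j (u i) := by
    rw [← Finset.sum_neg_distrib]
    nth_rewrite 1 [← h.sum_apply x]
    rw [← Finset.sum_sub_distrib]
    refine Finset.sum_congr rfl fun i _ => ?_
    have h1 : ∑ j ∈ Finset.univ.filter (fun j => i < j), Q j (u i) + Q i (u i) = u i := by
      conv_rhs => rw [← h.sum_apply (u i)]
      rw [← Finset.sum_filter_add_sum_filter_not Finset.univ (fun j => i < j) fun j => Q j (u i)]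
      congr 1
      refine (Finset.sum_eq_single (f := fun j => Q j (u i)) i (fun j hj hji => ?_)
        fun hi => ?_).symm
      · rw [Finset.mem_filter] at hj
        exact mem_flag.1 (hu i).2 j (Fin.lt_def.1 (lt_of_le_of_ne (not_lt.1 hj.2) hji))
      · simp at hi
    rw [hQu] at h1
    rw [← eq_sub_iff_add_eq] at h1
    rw [h1, neg_sub]
  rw [← map_sub, hdiff, map_neg, norm_neg, map_sum]
  refine (norm_sum_le _ _).trans ?_
  rw [Finset.sum_mul, Finset.sum_mul]
  refine Finset.sum_le_sum fun i _ => ?_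
  rw [map_sum, Finset.sum_mul, Finset.sum_mul]
  refine (norm_sum_le _ _).trans ?_
  calc _ ≤ ∑ j ∈ Finset.univ.filter (fun j => i < j),
          K * (M * C i) * M * ρ ^ n * ‖(Phi A n 0 : Op d) x‖ :=
        Finset.sum_le_sum fun j hj => hterm i j (Finset.mem_filter.1 hj).2
    _ ≤ _ := by
      refine Finset.sum_le_sum_of_subset_of_nonneg (Finset.filter_subset _ _) fun j _ _ => ?_
      have := hC0 i
      positivity

/-- Every subspace has the same rates as the sum of its graded pieces. -/
theorem rates_eq (h : IsDominatedSplitting A Q M K ρ) {V : Submodule ℝ (E d)}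
    (hV : 0 < Module.finrank ℝ V) :
    upperRate A V = upperRate A (⨆ i, gradedPiece Q V i) ∧
      lowerRate A V = lowerRate A (⨆ i, gradedPiece Q V i) := by
  obtain ⟨C, hC, hgap⟩ := h.exists_gap V
  exact rates_eq_of_gap hV (h.finrank_iSup_gradedPiece V) hC h.ρ_nonneg h.ρ_lt_one hgap

end IsDominatedSplitting

/-! ### The first inner angular value of a dominated splitting -/

namespace BoundedInvertible

/-- A bound `≥ 1` of the growth of orbits in both directions of time. -/
theorem exists_growth_bound {A : ℕ → (Op d)ˣ} (hA : BoundedInvertible A) :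
    ∃ L : ℝ, 1 ≤ L ∧ ∀ k p x,
      ‖(Phi A (k + p) 0 : Op d) x‖ ≤ L ^ p * ‖(Phi A k 0 : Op d) x‖ ∧
      ‖(Phi A k 0 : Op d) x‖ ≤ L ^ p * ‖(Phi A (k + p) 0 : Op d) x‖ := by
  obtain ⟨C, hC⟩ := hA
  refine ⟨max C 1, le_max_right _ _, fun k p x => ?_⟩
  set L := max C 1
  have hL : 0 ≤ L := zero_le_one.trans (le_max_right _ _)
  induction p with
  | zero => simp
  | succ p ih =>
    have hstep : (Phi A (k + (p + 1)) 0 : Op d) x = (A (k + p) : Op d) ((Phi A (k + p) 0 : Op d) x) := by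
      rw [← add_assoc, Phi_succ_left]; rfl
    have hback : (Phi A (k + p) 0 : Op d) x =
        (((A (k + p))⁻¹ : (Op d)ˣ) : Op d) ((Phi A (k + (p + 1)) 0 : Op d) x) := by
      rw [hstep]
      change _ = ((((A (k + p))⁻¹ : (Op d)ˣ) : Op d) * (A (k + p) : Op d)) _
      simp
    constructor
    · rw [hstep]
      calc _ ≤ L * ‖(Phi A (k + p) 0 : Op d) x‖ :=
            ContinuousLinearMap.le_of_opNorm_le _ ((hC (k + p)).1.trans (le_max_left _ _)) _
        _ ≤ L * (L ^ p * ‖(Phi A k 0 : Op d) x‖) := by gcongr; exact ih.1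
        _ = _ := by ring
    · calc _ ≤ L ^ p * ‖(Phi A (k + p) 0 : Op d) x‖ := ih.2
        _ ≤ L ^ p * (L * ‖(Phi A (k + (p + 1)) 0 : Op d) x‖) := by
          gcongr
          rw [hback]
          exact ContinuousLinearMap.le_of_opNorm_le _ ((hC (k + p)).2.trans (le_max_left _ _)) _
        _ = _ := by ring

end BoundedInvertible

theorem finrank_span_singleton_pos {v : E d} (hv : v ≠ 0) : 0 < Module.finrank ℝ (ℝ ∙ v) := by
  rw [finrank_span_singleton hv]; exact one_pos

theorem Phi_apply_ne_zero (A : ℕ → (Op d)ˣ) (n m : ℕ) {x : E d} (hx : x ≠ 0) :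
    (Phi A n m : Op d) x ≠ 0 := by
  intro h
  apply hx
  have : ((((Phi A n m)⁻¹ : (Op d)ˣ) : Op d) * (Phi A n m : Op d)) x = x := by simp
  rw [← this]
  change (((Phi A n m)⁻¹ : (Op d)ˣ) : Op d) ((Phi A n m : Op d) x) = 0
  rw [h, map_zero]

theorem ang_flow_span_le {A : ℕ → (Op d)ˣ} {w v : E d} (hw : w ≠ 0) {n : ℕ} {δ : ℝ} (hδ : 0 ≤ δ)
    (h : ‖(Phi A n 0 : Op d) w - (Phi A n 0 : Op d) v‖ ≤ δ * ‖(Phi A n 0 : Op d) w‖) :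
    ang (flow A n (ℝ ∙ w)) (flow A n (ℝ ∙ v)) ≤ Real.pi / 2 * δ := by
  refine ang_le_of_gap (by rw [finrank_flow]; exact finrank_span_singleton_pos hw) hδ ?_
  rintro _ ⟨x, hx, rfl⟩
  obtain ⟨c, rfl⟩ := Submodule.mem_span_singleton.1 hx
  refine ⟨_, ⟨c • v, Submodule.smul_mem _ _ (Submodule.mem_span_singleton_self v), rfl⟩, ?_⟩
  change ‖(Phi A n 0 : Op d) (c • w) - (Phi A n 0 : Op d) (c • v)‖ ≤
    δ * ‖(Phi A n 0 : Op d) (c • w)‖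
  rw [map_smul, map_smul, ← smul_sub, norm_smul, norm_smul, mul_left_comm]
  gcongr

/-- Two lines whose images stay `δ`-close during a window have close window sums. -/
theorem a_window_span_le {A : ℕ → (Op d)ˣ} {w v : E d} (hw : w ≠ 0) (hv : v ≠ 0) {k N : ℕ} {δ : ℝ}
    (hδ : 0 ≤ δ) (h : ∀ p ≤ N, ‖(Phi A (k + p) 0 : Op d) w - (Phi A (k + p) 0 : Op d) v‖ ≤
      δ * ‖(Phi A (k + p) 0 : Op d) w‖) :
    a A (k + 1) (k + N) (ℝ ∙ v) ≤ a A (k + 1) (k + N) (ℝ ∙ w) + N * (Real.pi * δ) := by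
  rw [a_window_eq, a_window_eq]
  calc _ ≤ ∑ j ∈ Finset.range N,
        (ang (flow A (k + j) (ℝ ∙ w)) (flow A (k + j + 1) (ℝ ∙ w)) + Real.pi * δ) := by
        refine Finset.sum_le_sum fun j hj => ?_
        rw [Finset.mem_range] at hj
        have h1 := ang_flow_span_le hw hδ (h j hj.le)
        have h2 := ang_flow_span_le hw hδ (h (j + 1) hj)
        have hfr : ∀ (n : ℕ) (x : E d), x ≠ 0 → Module.finrank ℝ (flow A n (ℝ ∙ x)) = 1 :=
          fun n x hx => by rw [finrank_flow, finrank_span_singleton hx]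
        have h3 := abs_ang_sub_ang_le (V := flow A (k + j) (ℝ ∙ v))
          (W := flow A (k + j + 1) (ℝ ∙ v)) (V' := flow A (k + j) (ℝ ∙ w))
          (W' := flow A (k + j + 1) (ℝ ∙ w)) (by simp [hfr _ _ hv]) (by simp [hfr _ _ hv])
          (by simp [hfr _ _ hv, hfr _ _ hw]) (by simp [hfr _ _ hv, hfr _ _ hw])
        have h4 := (abs_le.1 h3).2
        rw [← add_assoc] at h2
        linarith
    _ = _ := by rw [Finset.sum_add_distrib]; simp

namespace IsDominatedSplitting

variable {A : ℕ → (Op d)ˣ} {ℓ : ℕ} {Q : Fin ℓ → Op d} {M K ρ : ℝ}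

/-- The components `i`, `j` of the orbit of `v` have comparable size at time `k`. -/
def Comparable (A : ℕ → (Op d)ˣ) (Q : Fin ℓ → Op d) (η : ℝ) (v : E d) (i j : Fin ℓ) (k : ℕ) :
    Prop :=
  η * ‖(Phi A k 0 : Op d) (Q j v)‖ < ‖(Phi A k 0 : Op d) (Q i v)‖ ∧
    η * ‖(Phi A k 0 : Op d) (Q i v)‖ < ‖(Phi A k 0 : Op d) (Q j v)‖

/-- Comparability at two times keeps the ratio of the components from changing by more than `η ^ 2`,
whereas domination shrinks it by `K * ρ ^ B < η ^ 2` over `B` steps. So all such times lie within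
`B` steps of the first, and `B` does not depend on `v`. -/
theorem exists_card_comparable_le (h : IsDominatedSplitting A Q M K ρ) {η : ℝ} (hη : 0 < η) :
    ∃ B : ℕ, ∀ v i j, i < j → ∀ S : Finset ℕ, (∀ k ∈ S, Comparable A Q η v i j k) →
      S.card ≤ B := by
  have hlim : Tendsto (fun n : ℕ => K * ρ ^ n) atTop (𝓝 0) := by
    simpa using (tendsto_pow_atTop_nhds_zero_of_lt_one h.ρ_nonneg h.ρ_lt_one).const_mul K
  obtain ⟨B, hB⟩ := (hlim.eventually (gt_mem_nhds (show 0 < η * η by positivity))).exists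
  refine ⟨B, fun v i j hij S hS => ?_⟩
  rcases S.eq_empty_or_nonempty with rfl | hne
  · simp
  have hsub : S ⊆ Finset.Ico (S.min' hne) (S.min' hne + B) := by
    intro k hk
    rw [Finset.mem_Ico]
    have hmin := S.min'_le k hk
    refine ⟨hmin, ?_⟩
    by_contra! hlt
    obtain ⟨h1, -⟩ := hS _ (S.min'_mem hne)
    obtain ⟨-, h2⟩ := hS k hk
    have h3 := h.dominated i j hij (S.min' hne) k hmin v v
    have hpow : K * ρ ^ (k - S.min' hne) ≤ η * η := by
      refine le_trans ?_ hB.le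
      exact mul_le_mul_of_nonneg_left
        (pow_le_pow_of_le_one h.ρ_nonneg h.ρ_lt_one.le (by omega)) h.K_nonneg
    have h4 := mul_lt_mul'' h2 h1 (by positivity) (by positivity)
    have h5 := h3.trans (mul_le_mul_of_nonneg_right hpow (by positivity))
    nlinarith
  simpa using Finset.card_le_card hsub

/-- The initial vector `v` is `η`-dominated at time `k` by one of its components. -/
def DominatedAt (A : ℕ → (Op d)ˣ) (Q : Fin ℓ → Op d) (η : ℝ) (v : E d) (k : ℕ) : Prop :=
  ∃ i, Q i v ≠ 0 ∧ ∀ j, j ≠ i →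
    ‖(Phi A k 0 : Op d) (Q j v)‖ ≤ η * ‖(Phi A k 0 : Op d) (Q i v)‖

/-- The largest component at time `k` dominates: any other one exceeding `η` times its size would be
comparable to it. -/
theorem dominatedAt_of_not_comparable (h : IsDominatedSplitting A Q M K ρ) {η : ℝ} (hη0 : 0 < η)
    {v : E d} (hv : v ≠ 0) {k : ℕ}
    (hk : ∀ i j, i < j → ¬ Comparable A Q η v i j k) : DominatedAt A Q η v k := by
  have hne : Nonempty (Fin ℓ) := by
    by_contra hemp
    rw [not_nonempty_iff] at hemp
    exact hv (by rw [← h.sum_apply v]; simp)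
  obtain ⟨i, hi⟩ := Finite.exists_max fun i => ‖(Phi A k 0 : Op d) (Q i v)‖
  have hi0 : Q i v ≠ 0 := by
    intro h0
    apply hv
    rw [← h.sum_apply v]
    refine Finset.sum_eq_zero fun j _ => ?_
    by_contra hj
    have h1 := hi j
    rw [h0, map_zero, norm_zero] at h1
    exact Phi_apply_ne_zero A k 0 hj (norm_le_zero_iff.1 h1)
  refine ⟨i, hi0, fun j hj => ?_⟩
  have hpos : 0 < ‖(Phi A k 0 : Op d) (Q i v)‖ := norm_pos_iff.2 (Phi_apply_ne_zero A k 0 hi0)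
  by_contra! hlt
  -- `hlt` and the maximality of `i` force `η < 1`.
  have h2 : η * ‖(Phi A k 0 : Op d) (Q j v)‖ < ‖(Phi A k 0 : Op d) (Q i v)‖ := by
    nlinarith [hi j, norm_nonneg ((Phi A k 0 : Op d) (Q j v))]
  rcases lt_or_gt_of_ne hj with hji | hij
  · exact hk j i hji ⟨hlt, h2⟩
  · exact hk i j hij ⟨h2, hlt⟩

theorem exists_card_not_dominatedAt_le (h : IsDominatedSplitting A Q M K ρ) {η : ℝ} (hη0 : 0 < η) :
    ∃ B : ℕ, ∀ v ≠ 0, ∀ S : Finset ℕ, (∀ k ∈ S, ¬ DominatedAt A Q η v k) →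
      S.card ≤ B := by
  classical
  obtain ⟨B, hB⟩ := h.exists_card_comparable_le hη0
  refine ⟨∑ _p : Fin ℓ × Fin ℓ, B, fun v hv S hS => ?_⟩
  have hsub : S ⊆ Finset.univ.biUnion fun p : Fin ℓ × Fin ℓ =>
      S.filter fun k => p.1 < p.2 ∧ Comparable A Q η v p.1 p.2 k := by
    intro k hk
    have h1 : ∃ i j, i < j ∧ Comparable A Q η v i j k := by
      by_contra! hcon
      exact hS k hk (h.dominatedAt_of_not_comparable hη0 hv hcon)
    obtain ⟨i, j, hij, hc⟩ := h1
    simp only [Finset.mem_biUnion, Finset.mem_univ, true_and, Finset.mem_filter]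
    exact ⟨(i, j), hk, hij, hc⟩
  refine (Finset.card_le_card hsub).trans (Finset.card_biUnion_le.trans ?_)
  refine Finset.sum_le_sum fun p _ => ?_
  by_cases hp : p.1 < p.2
  · exact hB v p.1 p.2 hp _ fun k hk => (Finset.mem_filter.1 hk).2.2
  · simp [hp]

/-- Within `N` steps a ratio of two components worsens at most by `L ^ N * L ^ N`, one factor for
the growth of the small component and one for the decay of the large one. The factor `ℓ` bounds the
number of small components. -/
theorem norm_sub_le_of_dominated (h : IsDominatedSplitting A Q M K ρ) {L η : ℝ} (hL : 1 ≤ L)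
    (hη : 0 ≤ η) (hgrow : ∀ k p x,
      ‖(Phi A (k + p) 0 : Op d) x‖ ≤ L ^ p * ‖(Phi A k 0 : Op d) x‖ ∧
      ‖(Phi A k 0 : Op d) x‖ ≤ L ^ p * ‖(Phi A (k + p) 0 : Op d) x‖)
    {v : E d} {k N : ℕ} {i : Fin ℓ} (hi : ∀ j, j ≠ i →
      ‖(Phi A k 0 : Op d) (Q j v)‖ ≤ η * ‖(Phi A k 0 : Op d) (Q i v)‖) {p : ℕ} (hp : p ≤ N) :
    ‖(Phi A (k + p) 0 : Op d) (Q i v) - (Phi A (k + p) 0 : Op d) v‖ ≤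
      (ℓ * L ^ N * L ^ N * η) * ‖(Phi A (k + p) 0 : Op d) (Q i v)‖ := by
  classical
  have h1 : Q i v - v = -∑ j ∈ Finset.univ.erase i, Q j v := by
    nth_rewrite 2 [← h.sum_apply v]
    rw [← Finset.add_sum_erase _ _ (Finset.mem_univ i)]
    abel
  have hLN : L ^ p ≤ L ^ N := pow_le_pow_right₀ hL hp
  have hL0 : 0 ≤ L := zero_le_one.trans hL
  rw [← map_sub, h1, map_neg, norm_neg, map_sum]
  refine (norm_sum_le _ _).trans ?_
  calc _ ≤ ∑ _j ∈ Finset.univ.erase i, L ^ N * L ^ N * η * ‖(Phi A (k + p) 0 : Op d) (Q i v)‖ := by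
        refine Finset.sum_le_sum fun j hj => ?_
        calc _ ≤ L ^ p * ‖(Phi A k 0 : Op d) (Q j v)‖ := (hgrow k p _).1
          _ ≤ L ^ p * (η * (L ^ p * ‖(Phi A (k + p) 0 : Op d) (Q i v)‖)) := by
            gcongr
            exact (hi j (Finset.ne_of_mem_erase hj)).trans (by gcongr; exact (hgrow k p _).2)
          _ ≤ L ^ N * (η * (L ^ N * ‖(Phi A (k + p) 0 : Op d) (Q i v)‖)) := by gcongr
          _ = _ := by ring
    _ ≤ ∑ _j : Fin ℓ, L ^ N * L ^ N * η * ‖(Phi A (k + p) 0 : Op d) (Q i v)‖ :=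
      Finset.sum_le_sum_of_subset_of_nonneg (Finset.erase_subset _ _) fun _ _ _ => by positivity
    _ = _ := by simp; ring

/-- Long windows are bounded by the suprema over short windows in the summands, up to a small
error per short window and a bounded number of exceptional windows. -/
theorem exists_a_window_mul_le (h : IsDominatedSplitting A Q M K ρ) (hA : BoundedInvertible A)
    {N : ℕ} (hN : 0 < N) {S ε : ℝ} (hε : 0 < ε)
    (hS : ∀ i v, Q i v ≠ 0 → ∀ k, a A (k + 1) (k + N) (ℝ ∙ Q i v) ≤ S) (hS0 : 0 ≤ S) :
    ∃ D : ℝ, 0 ≤ D ∧ ∀ v ≠ 0, ∀ k q, a A (k + 1) (k + q * N) (ℝ ∙ v) ≤ q * (S + N * ε) + D := by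
  classical
  have hpi := Real.pi_pos
  obtain ⟨L, hL, hgrow⟩ := hA.exists_growth_bound
  have hL0 : 0 ≤ L := zero_le_one.trans hL
  set G : ℝ := Real.pi * (ℓ * L ^ N * L ^ N) with hG
  have hG0 : 0 ≤ G := by positivity
  -- `G * η` is the error per step within a window starting at an `η`-dominated time. The summand
  -- `1` avoids division by zero.
  set η : ℝ := ε / (G + 1)
  have hη0 : 0 < η := by positivity
  have hGη : G * η ≤ ε := by
    calc G * η ≤ (G + 1) * (ε / (G + 1)) := by
          gcongr
          linarith
      _ = ε := by field_simp
  obtain ⟨B, hB⟩ := h.exists_card_not_dominatedAt_le hη0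
  -- At most `B` blocks start at a time that is not dominated, and each contributes at most `N * (π
  -- / 2)`.
  refine ⟨B * (N * (Real.pi / 2)), by positivity, fun v hv k q => ?_⟩
  have hblock : ∀ k, a A (k + 1) (k + N) (ℝ ∙ v) ≤
      (S + N * ε) + if DominatedAt A Q η v k then 0 else N * (Real.pi / 2) := by
    intro k
    split_ifs with hk
    · obtain ⟨i, hi0, hi⟩ := hk
      rw [add_zero]
      refine (a_window_span_le hi0 hv (δ := ℓ * L ^ N * L ^ N * η) (by positivity)
        fun p hp => h.norm_sub_le_of_dominated hL hη0.le hgrow hi hp).trans ?_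
      refine add_le_add (hS i v hi0 k) ?_
      gcongr
      rw [← mul_assoc]
      exact hGη
    · have := a_window_le A (ℝ ∙ v) k N
      have : 0 ≤ S + N * ε := by positivity
      linarith
  have hsum : a A (k + 1) (k + q * N) (ℝ ∙ v) =
      ∑ p ∈ Finset.range q, a A (k + p * N + 1) (k + p * N + N) (ℝ ∙ v) := by
    induction q with
    | zero => simp [a]
    | succ q ih =>
      rw [Finset.sum_range_succ, ← ih, add_mul, one_mul, a_window_add]
  -- Different blocks start at different times because `0 < N`, so the bound for bad times also
  -- counts bad blocks.
  have hcard : ((Finset.range q).filter fun p => ¬ DominatedAt A Q η v (k + p * N)).card ≤ B := by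
    rw [← Finset.card_image_of_injective (f := fun p => k + p * N) _ fun p p' hpp => by
      simpa [hN.ne'] using hpp]
    refine hB v hv _ fun k' hk' => ?_
    obtain ⟨p, hp, rfl⟩ := Finset.mem_image.1 hk'
    exact (Finset.mem_filter.1 hp).2
  rw [hsum]
  calc _ ≤ ∑ p ∈ Finset.range q, ((S + N * ε) +
          if DominatedAt A Q η v (k + p * N) then 0 else N * (Real.pi / 2)) :=
        Finset.sum_le_sum fun p _ => hblock _
    _ = q * (S + N * ε) + ((Finset.range q).filter
          fun p => ¬ DominatedAt A Q η v (k + p * N)).card * (N * (Real.pi / 2)) := by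
      rw [Finset.sum_add_distrib, Finset.sum_ite]
      simp only [Finset.sum_const, Finset.card_range, nsmul_eq_mul, smul_zero, zero_add]
    _ ≤ _ := by gcongr

theorem exists_eq_span_singleton {V : Submodule ℝ (E d)} (hV : V ∈ grassmannian 1 d) :
    ∃ v ≠ 0, V = ℝ ∙ v := by
  obtain ⟨v, hv, hspan⟩ := finrank_eq_one_iff'.1 (show Module.finrank ℝ V = 1 from hV)
  refine ⟨v, fun h => hv (Subtype.ext h), le_antisymm (fun w hw => ?_) ?_⟩
  · obtain ⟨c, hc⟩ := hspan ⟨w, hw⟩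
    exact Submodule.mem_span_singleton.2 ⟨c, congrArg Subtype.val hc⟩
  · rw [Submodule.span_singleton_le_iff_mem]
    exact v.2

/-- The first uniform inner angular value is bounded by those of the summands. -/
theorem upperUniformInner_le (h : IsDominatedSplitting A Q M K ρ) (hA : BoundedInvertible A)
    {θ : ℝ} (hθ0 : 0 ≤ θ) (hθ : ∀ i, innerOn A (Q i : E d →ₗ[ℝ] E d).range ≤ θ) :
    upperUniformInner A 1 ≤ θ := by
  refine le_of_forall_pos_le_add fun ε hε => ?_
  have hev : ∀ᶠ N : ℕ in atTop, 0 < N ∧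
      ∀ i, innerMeanOn A (Q i : E d →ₗ[ℝ] E d).range N < θ + ε / 2 := by
    refine (eventually_gt_atTop 0).and (eventually_all.2 fun i => ?_)
    exact (tendsto_innerMeanOn A _).eventually (gt_mem_nhds ((hθ i).trans_lt (by linarith)))
  obtain ⟨N, hN, hlt⟩ := hev.exists
  have hN' : (0 : ℝ) < N := Nat.cast_pos.2 hN
  have hS : ∀ i v, Q i v ≠ 0 → ∀ k, a A (k + 1) (k + N) (ℝ ∙ Q i v) ≤ N * (θ + ε / 2) := by
    intro i v hv k
    have h1 := hlt i
    rw [innerMeanOn_eq, one_div, inv_mul_lt_iff₀ hN'] at h1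
    exact (le_windowSup A (fun v : {v : E d // v ∈ (Q i : E d →ₗ[ℝ] E d).range ∧ v ≠ 0} =>
      ℝ ∙ (v : E d)) ⟨Q i v, ⟨v, rfl⟩, hv⟩ k N).trans h1.le
  -- One half of `ε` is used for the suprema over windows of length `N`, the other for the error per
  -- block. The limit is known to exist, so multiples of `N` suffice.
  obtain ⟨D, hD0, hD⟩ := h.exists_a_window_mul_le hA hN (half_pos hε) hS (by positivity)
  have hmul : Tendsto (fun q : ℕ => q * N) atTop atTop := tendsto_id.atTop_mul_const' hN
  have hlim := (tendsto_innerMean A 1).comp hmul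
  have hrhs : Tendsto (fun q : ℕ => (θ + ε) + 1 / (q : ℝ) * (D / N)) atTop (𝓝 (θ + ε)) := by
    simpa using tendsto_const_nhds.add (tendsto_one_div_mul_const (D / N))
  refine le_of_tendsto_of_tendsto hlim hrhs ?_
  filter_upwards [eventually_gt_atTop 0] with q hq
  have hq' : (0 : ℝ) < q := Nat.cast_pos.2 hq
  have hle : windowSup A (fun V : grassmannian 1 d => (V : Submodule ℝ (E d))) (q * N) ≤
      q * (N * (θ + ε / 2) + N * (ε / 2)) + D := by
    refine windowSup_le A _ (by positivity) fun V k => ?_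
    obtain ⟨v, hv, hV⟩ := exists_eq_span_singleton V.2
    rw [hV]
    exact hD v hv k q
  simp only [Function.comp_apply]
  rw [innerMean_eq, one_div, inv_mul_le_iff₀ (by positivity)]
  refine hle.trans (le_of_eq ?_)
  push_cast
  field_simp
  ring

end IsDominatedSplitting

theorem innerOn_le_upperUniformInner (A : ℕ → (Op d)ˣ) (V : Submodule ℝ (E d)) :
    innerOn A V ≤ upperUniformInner A 1 := by
  refine le_of_tendsto_of_tendsto' (tendsto_innerMeanOn A V) (tendsto_innerMean A 1) fun n => ?_
  rw [innerMeanOn_eq, innerMean_eq]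
  gcongr
  exact windowSup_le A _ (windowSup_nonneg A _ n) fun v k =>
    le_windowSup A (fun V : grassmannian 1 d => (V : Submodule ℝ (E d)))
      ⟨ℝ ∙ (v : E d), finrank_span_singleton v.2.2⟩ k n

theorem innerOn_nonneg (A : ℕ → (Op d)ˣ) (V : Submodule ℝ (E d)) : 0 ≤ innerOn A V :=
  ge_of_tendsto' (tendsto_innerMeanOn A V) fun n => by
    rw [innerMeanOn_eq]
    exact mul_nonneg (by positivity) (windowSup_nonneg A _ n)

/-! ### From exponential dichotomies to a dominated splitting -/

theorem fromZero_scaled (A : ℕ → (Op d)ˣ) (γ : ℝˣ) (n : ℕ) :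
    fromZero (scaled A γ) n =
      Units.map (algebraMap ℝ (Op d) : ℝ →* Op d) (γ⁻¹ ^ n) * fromZero A n := by
  induction n with
  | zero => simp [fromZero]
  | succ n ih =>
    rw [fromZero, ih, scaled, fromZero, pow_succ', map_mul]
    ext1
    simp only [Units.val_mul, Units.coe_map, MonoidHom.coe_coe]
    rw [mul_assoc, ← mul_assoc (A n : Op d), ← Algebra.commutes, mul_assoc, mul_assoc]

/-- Scaling multiplies `Φ(n,m)` by `γ ^ (m - n)`; the powers are distributed to avoid negative
exponents. -/
theorem norm_Phi_scaled_apply (A : ℕ → (Op d)ˣ) {γ : ℝˣ} (hγ : (0 : ℝ) < γ) (n m : ℕ) (x : E d) :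
    ‖(Phi (scaled A γ) n m : Op d) x‖ * (γ : ℝ) ^ n = γ ^ m * ‖(Phi A n m : Op d) x‖ := by
  have h : (Phi (scaled A γ) n m : Op d) = ((γ : ℝ)⁻¹ ^ n * γ ^ m) • (Phi A n m : Op d) := by
    have h1 : Phi (scaled A γ) n m =
        Units.map (algebraMap ℝ (Op d) : ℝ →* Op d) (γ⁻¹ ^ n * γ ^ m) * Phi A n m := by
      rw [Phi, fromZero_scaled, fromZero_scaled, mul_inv_rev, ← map_inv, Phi, map_mul]
      have hc : ∀ (c : ℝˣ) (X : (Op d)ˣ),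
          X * Units.map (algebraMap ℝ (Op d) : ℝ →* Op d) c =
            Units.map (algebraMap ℝ (Op d) : ℝ →* Op d) c * X := fun c X => by
        ext1
        exact (Algebra.commutes (c : ℝ) (X : Op d)).symm
      rw [hc, inv_pow γ m, inv_inv, mul_assoc, mul_assoc, ← mul_assoc (fromZero A n), hc]
      simp only [mul_assoc]
    rw [h1]
    refine Eq.trans ?_ (Algebra.smul_def ((γ : ℝ)⁻¹ ^ n * γ ^ m) (Phi A n m : Op d)).symm
    simp [-map_pow]
  rw [h, smul_apply, norm_smul, Real.norm_of_nonneg (by positivity), inv_pow]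
  field_simp

/-- The consequences of an exponential dichotomy of the system scaled by `γ` for the orbits of `A`,
in terms of the stable projector `R` at time `0`. -/
structure OrbitDichotomy (A : ℕ → (Op d)ˣ) (γ K α β : ℝ) (R : Op d) : Prop where
  γ_pos : 0 < γ
  K_pos : 0 < K
  α_mem : α ∈ Set.Ioo (0 : ℝ) 1
  β_mem : β ∈ Set.Ioo (0 : ℝ) 1
  proj : R * R = R
  norm_le : ∀ n x, ‖(Phi A n 0 : Op d) (R x)‖ ≤ K * ‖(Phi A n 0 : Op d) x‖
  stable : ∀ m n, m ≤ n → ∀ x,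
    ‖(Phi A n 0 : Op d) (R x)‖ ≤ K * (γ * α) ^ (n - m) * ‖(Phi A m 0 : Op d) (R x)‖
  unstable : ∀ m n, m ≤ n → ∀ x,
    ‖(Phi A m 0 : Op d) ((1 - R) x)‖ ≤ K * (β / γ) ^ (n - m) * ‖(Phi A n 0 : Op d) ((1 - R) x)‖

theorem Phi_mul_Phi (A : ℕ → (Op d)ˣ) (n m k : ℕ) : Phi A n m * Phi A m k = Phi A n k := by
  simp [Phi, mul_assoc]

theorem Phi_Phi_apply (A : ℕ → (Op d)ˣ) (n m k : ℕ) (x : E d) :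
    (Phi A n m : Op d) ((Phi A m k : Op d) x) = (Phi A n k : Op d) x := by
  rw [← Phi_mul_Phi A n m k]; rfl

theorem IsDichotomy.orbitDichotomy {A : ℕ → (Op d)ˣ} {γ : ℝˣ} (hγ : (0 : ℝ) < γ) {K α β : ℝ}
    {P : ℕ → Op d} (h : IsDichotomy (scaled A γ) K α β P) : OrbitDichotomy A γ K α β (P 0) := by
  set B := scaled A γ
  have hK := h.K_pos
  have hinv : ∀ n x, (Phi B n 0 : Op d) (P 0 x) = P n ((Phi B n 0 : Op d) x) := fun n x =>
    (congrArg (fun T : Op d => T x) (h.invariant n 0)).symm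
  have hproj : ∀ n x, P n (P n x) = P n x := fun n x => congrArg (fun T : Op d => T x) (h.proj n)
  have hscale : ∀ n x, ‖(Phi A n 0 : Op d) x‖ = γ ^ n * ‖(Phi B n 0 : Op d) x‖ := fun n x => by
    have := norm_Phi_scaled_apply A hγ n 0 x
    rw [pow_zero, one_mul] at this
    rw [← this, mul_comm]
  have hpow : ∀ m n, m ≤ n → (γ : ℝ) ^ n = γ ^ (n - m) * γ ^ m := fun m n hmn => by
    rw [← pow_add, Nat.sub_add_cancel hmn]
  refine ⟨hγ, hK, h.αs_mem, h.αu_mem, h.proj 0, fun n x => ?_, fun m n hmn x => ?_,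
    fun m n hmn x => ?_⟩
  · rw [hscale, hscale, mul_left_comm]
    gcongr
    rw [hinv]
    -- The stable estimate at equal times says `‖P n‖ ≤ K`.
    refine ContinuousLinearMap.le_of_opNorm_le _ ?_ _
    simpa [Phi_self] using h.stable n n le_rfl
  · have h1 : (Phi B n 0 : Op d) (P 0 x) =
        ((Phi B n m : Op d) * P m) ((Phi B m 0 : Op d) (P 0 x)) := by
      change _ = (Phi B n m : Op d) (P m ((Phi B m 0 : Op d) (P 0 x)))
      rw [← hinv, hproj, Phi_Phi_apply]
    have h2 : ‖(Phi B n 0 : Op d) (P 0 x)‖ ≤ K * α ^ (n - m) * ‖(Phi B m 0 : Op d) (P 0 x)‖ := by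
      rw [h1]
      exact ContinuousLinearMap.le_of_opNorm_le _ (h.stable n m hmn) _
    rw [hscale, hscale m]
    calc _ ≤ (γ : ℝ) ^ n * (K * α ^ (n - m) * ‖(Phi B m 0 : Op d) (P 0 x)‖) := by gcongr
      _ = _ := by rw [hpow m n hmn, mul_pow]; ring
  · have hinv' : ∀ n x, (Phi B n 0 : Op d) ((1 - P 0) x) = (1 - P n) ((Phi B n 0 : Op d) x) :=
      fun n x => by
        simp only [sub_apply, one_apply_eq_self, map_sub, hinv]
    have hproj' : (1 - P 0) ((1 - P 0) x) = (1 - P 0) x := by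
      simp [hproj]
    have h1 : (Phi B m 0 : Op d) ((1 - P 0) x) =
        ((Phi B m n : Op d) * (1 - P n)) ((Phi B n 0 : Op d) ((1 - P 0) x)) := by
      change _ = (Phi B m n : Op d) ((1 - P n) ((Phi B n 0 : Op d) ((1 - P 0) x)))
      rw [← hinv', hproj', Phi_Phi_apply]
    have h2 : ‖(Phi B m 0 : Op d) ((1 - P 0) x)‖ ≤
        K * β ^ (n - m) * ‖(Phi B n 0 : Op d) ((1 - P 0) x)‖ := by
      rw [h1]
      exact ContinuousLinearMap.le_of_opNorm_le _ (h.unstable n m hmn) _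
    rw [hscale, hscale n]
    calc _ ≤ (γ : ℝ) ^ m * (K * β ^ (n - m) * ‖(Phi B n 0 : Op d) ((1 - P 0) x)‖) := by gcongr
      _ = _ := by
        rw [hpow m n hmn, div_pow]
        field_simp

/-- The orbit of `x` grows at most like `γ ^ n`. -/
def GrowthLE (A : ℕ → (Op d)ˣ) (γ : ℝ) (x : E d) : Prop :=
  ∃ C : ℝ, ∀ n, ‖(Phi A n 0 : Op d) x‖ ≤ C * γ ^ n

theorem GrowthLE.mono {A : ℕ → (Op d)ˣ} {γ γ' : ℝ} {x : E d} (hγ : 0 < γ) (h : γ ≤ γ')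
    (hx : GrowthLE A γ x) : GrowthLE A γ' x := by
  obtain ⟨C, hC⟩ := hx
  have hC0 : 0 ≤ C := by simpa using (norm_nonneg _).trans (hC 0)
  exact ⟨C, fun n => (hC n).trans (by gcongr)⟩

namespace OrbitDichotomy

variable {A : ℕ → (Op d)ˣ} {γ K α β : ℝ} {R : Op d}

/-- A nonzero unstable part grows at least like `(γ / β) ^ n`, which excludes growth of order `γ' ^
n`, and a stable orbit is of order `(γ * α) ^ n`. So the range of `R` depends on the system and the
rate only, and it is constant for rates near `γ`. -/
theorem growthLE_iff (h : OrbitDichotomy A γ K α β R) {γ' : ℝ} (h1 : γ * α ≤ γ') (h2 : γ' < γ / β)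
    (x : E d) : GrowthLE A γ' x ↔ R x = x := by
  have hγ := h.γ_pos
  have hK := h.K_pos
  have hα := h.α_mem.1
  have hβ := h.β_mem.1
  have hγ' : 0 < γ' := lt_of_lt_of_le (by positivity) h1
  constructor
  · rintro ⟨C, hC⟩
    set y := (1 - R) x with hy
    have hyx : y = x - R x := by simp [hy]
    have hbd : ∀ n, ‖y‖ ≤ K * ((1 + K) * C) * (β / γ * γ') ^ n := fun n => by
      have e1 := h.unstable 0 n (Nat.zero_le n) x
      simp only [Phi_self, Units.val_one, one_apply_eq_self, Nat.sub_zero] at e1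
      refine e1.trans ?_
      have e2 : ‖(Phi A n 0 : Op d) y‖ ≤ (1 + K) * (C * γ' ^ n) := by
        rw [hyx, map_sub]
        calc _ ≤ ‖(Phi A n 0 : Op d) x‖ + ‖(Phi A n 0 : Op d) (R x)‖ := norm_sub_le _ _
          _ ≤ ‖(Phi A n 0 : Op d) x‖ + K * ‖(Phi A n 0 : Op d) x‖ := by gcongr; exact h.norm_le n x
          _ = (1 + K) * ‖(Phi A n 0 : Op d) x‖ := by ring
          _ ≤ _ := by gcongr; exact hC n
      calc _ ≤ K * (β / γ) ^ n * ((1 + K) * (C * γ' ^ n)) := by gcongr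
        _ = _ := by rw [mul_pow]; ring
    have hlt : β / γ * γ' < 1 := by
      rw [div_mul_eq_mul_div, div_lt_one hγ]
      rwa [lt_div_iff₀ hβ, mul_comm] at h2
    have hlim : Tendsto (fun n : ℕ => K * ((1 + K) * C) * (β / γ * γ') ^ n) atTop (𝓝 0) := by
      simpa using (tendsto_pow_atTop_nhds_zero_of_lt_one (by positivity) hlt).const_mul
        (K * ((1 + K) * C))
    have : ‖y‖ ≤ 0 := ge_of_tendsto' hlim hbd
    rw [norm_le_zero_iff, hyx, sub_eq_zero] at this
    exact this.symm
  · intro hx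
    refine ⟨K * ‖x‖, fun n => ?_⟩
    have e1 := h.stable 0 n (Nat.zero_le n) x
    simp only [Phi_self, Units.val_one, one_apply_eq_self, Nat.sub_zero, hx] at e1
    calc _ ≤ K * (γ * α) ^ n * ‖x‖ := e1
      _ ≤ K * γ' ^ n * ‖x‖ := by gcongr
      _ = _ := by ring

theorem growthLE_self_iff (h : OrbitDichotomy A γ K α β R) (x : E d) :
    GrowthLE A γ x ↔ R x = x := by
  have hγ := h.γ_pos
  refine h.growthLE_iff (mul_le_of_le_one_right hγ.le h.α_mem.2.le) ?_ x
  rw [lt_div_iff₀ h.β_mem.1]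
  exact mul_lt_of_lt_one_right hγ h.β_mem.2

theorem eventually_growthLE_iff (h : OrbitDichotomy A γ K α β R) (x : E d) :
    ∀ᶠ γ' in 𝓝 γ, (GrowthLE A γ x ↔ GrowthLE A γ' x) := by
  have hγ := h.γ_pos
  have h1 : γ * α < γ := mul_lt_of_lt_one_right hγ h.α_mem.2
  have h2 : γ < γ / β := by
    rw [lt_div_iff₀ h.β_mem.1]
    exact mul_lt_of_lt_one_right hγ h.β_mem.2
  filter_upwards [Ioo_mem_nhds h1 h2] with γ' hγ'
  rw [h.growthLE_self_iff, h.growthLE_iff hγ'.1.le hγ'.2]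

end OrbitDichotomy

/-- Outside of the dichotomy spectrum the growth condition is locally independent of the rate. -/
theorem growthLE_iff_of_disjoint {A : ℕ → (Op d)ˣ} {s : Set ℝ} (hs : IsPreconnected s)
    (hpos : ∀ t ∈ s, 0 < t) (hdisj : ∀ t ∈ s, t ∉ dichotomySpectrum A) {t t' : ℝ} (ht : t ∈ s)
    (ht' : t' ∈ s) (x : E d) : GrowthLE A t x ↔ GrowthLE A t' x := by
  -- An equivalence relation whose classes are locally open in a preconnected set is total.
  refine hs.induction₂ (fun t t' => GrowthLE A t x ↔ GrowthLE A t' x) (fun t ht => ?_)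
    (fun _ _ _ _ _ _ => Iff.trans) (fun _ _ _ _ => Iff.symm) ht ht'
  have h1 := hdisj t ht
  simp only [dichotomySpectrum, Set.mem_ofPred_eq, not_and, not_forall, not_not] at h1
  obtain ⟨γ, rfl, P, K, α, β, hP⟩ := h1 (hpos t ht)
  exact nhdsWithin_le_nhds ((hP.orbitDichotomy (hpos _ ht)).eventually_growthLE_iff x)

/-- The rate can be moved up, off the spectrum, beyond the growth bound `L`, where the condition is
trivial. -/
theorem growthLE_of_forall_le_notMem {A : ℕ → (Op d)ˣ} (hA : BoundedInvertible A) {γ : ℝ}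
    (hγ : 0 < γ) (h : ∀ t, γ ≤ t → t ∉ dichotomySpectrum A) (x : E d) : GrowthLE A γ x := by
  obtain ⟨L, hL, hgrow⟩ := hA.exists_growth_bound
  rw [growthLE_iff_of_disjoint (isPreconnected_Ici (a := γ)) (fun t ht => hγ.trans_le ht)
    (fun t ht => h t ht) Set.self_mem_Ici (Set.mem_Ici.2 (le_max_left γ L)) x]
  refine GrowthLE.mono (γ := L) (by linarith) (le_max_right _ _) ⟨‖x‖, fun n => ?_⟩
  have := (hgrow 0 n x).1
  rw [zero_add, Phi_self] at this
  rw [mul_comm]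
  exact this

theorem eq_zero_of_growthLE {A : ℕ → (Op d)ˣ} (hA : BoundedInvertible A) {γ : ℝ}
    (hγ : 0 < γ) (h : ∀ t, 0 < t → t ≤ γ → t ∉ dichotomySpectrum A) {x : E d}
    (hx : GrowthLE A γ x) : x = 0 := by
  obtain ⟨L, hL, hgrow⟩ := hA.exists_growth_bound
  have hL0 : 0 < L := by linarith
  -- No nonzero orbit decays faster than `L⁻¹ ^ n`; the factor `2` leaves a strict decay `(1 / 2) ^
  -- n` for `‖x‖`.
  have hmin : min γ (1 / (2 * L)) ∈ Set.Ioc 0 γ :=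
    ⟨lt_min hγ (by positivity), min_le_left _ _⟩
  rw [growthLE_iff_of_disjoint (isPreconnected_Ioc (a := 0) (b := γ)) (fun t ht => ht.1)
    (fun t ht => h t ht.1 ht.2) ⟨hγ, le_rfl⟩ hmin x] at hx
  obtain ⟨C, hC⟩ := hx.mono hmin.1 (min_le_right _ _)
  have hbd : ∀ n, ‖x‖ ≤ C * (1 / 2) ^ n := fun n => by
    have h1 := (hgrow 0 n x).2
    rw [zero_add, Phi_self] at h1
    calc ‖x‖ ≤ L ^ n * ‖(Phi A n 0 : Op d) x‖ := h1
      _ ≤ L ^ n * (C * (1 / (2 * L)) ^ n) := by gcongr; exact hC n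
      _ = C * (L * (1 / (2 * L))) ^ n := by rw [mul_pow]; ring
      _ = _ := by
        congr 2
        field_simp
  have hlim : Tendsto (fun n : ℕ => C * (1 / 2 : ℝ) ^ n) atTop (𝓝 0) := by
    simpa using (tendsto_pow_atTop_nhds_zero_of_lt_one (r := (1 / 2 : ℝ)) (by norm_num)
      (by norm_num)).const_mul C
  exact norm_le_zero_iff.1 (ge_of_tendsto' hlim hbd)

/-! ### The splitting given by the spectral fibers -/

/-- A decreasing chain `R 0 = 1, ..., R ℓ = 0` of stable projectors at time `0`: the ranges are
nested, whereas the kernels need not be. -/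
structure IsDichotomyChain (A : ℕ → (Op d)ˣ) {ℓ : ℕ} (R : Fin (ℓ + 1) → Op d)
    (γ K α β : Fin (ℓ + 1) → ℝ) : Prop where
  dichotomy : ∀ p, OrbitDichotomy A (γ p) (K p) (α p) (β p) (R p)
  first : R 0 = 1
  last : R (Fin.last ℓ) = 0
  mul_eq_right : ∀ p q, p ≤ q → R p * R q = R q

namespace IsDichotomyChain

variable {A : ℕ → (Op d)ˣ} {ℓ : ℕ} {R : Fin (ℓ + 1) → Op d} {γ K α β : Fin (ℓ + 1) → ℝ}

/-- The product `R k * ... * R 1`: the projector with the range of `R k` and nested kernels. -/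
def nested (R : Fin (ℓ + 1) → Op d) (k : Fin (ℓ + 1)) : Op d :=
  Fin.induction (motive := fun _ => Op d) 1 (fun i T => R i.succ * T) k

theorem nested_zero (R : Fin (ℓ + 1) → Op d) : nested R 0 = 1 := rfl

theorem nested_succ (R : Fin (ℓ + 1) → Op d) (i : Fin ℓ) :
    nested R i.succ = R i.succ * nested R i.castSucc :=
  Fin.induction_succ _ _ i

theorem mul_nested (h : IsDichotomyChain A R γ K α β) (k : Fin (ℓ + 1)) :
    ∀ j ≤ k, R j * nested R k = nested R k := by
  induction k using Fin.induction with
  | zero =>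
    intro j hj
    rw [Fin.le_zero_iff.1 hj, h.first, one_mul]
  | succ i ih =>
    intro j hj
    rw [nested_succ, ← mul_assoc, h.mul_eq_right _ _ hj]

theorem nested_mul_of_le (h : IsDichotomyChain A R γ K α β) (k : Fin (ℓ + 1)) :
    ∀ j ≤ k, nested R j * R k = R k := by
  intro j
  induction j using Fin.induction with
  | zero => intro _; rw [nested_zero, one_mul]
  | succ i ih =>
    intro hi
    rw [nested_succ, mul_assoc, ih ((Fin.castSucc_lt_succ (i := i)).le.trans hi),
      h.mul_eq_right _ _ hi]

theorem nested_mul_nested_of_le (h : IsDichotomyChain A R γ K α β) {j k : Fin (ℓ + 1)}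
    (hjk : j ≤ k) : nested R j * nested R k = nested R k := by
  rw [← h.mul_nested k k le_rfl, ← mul_assoc, h.nested_mul_of_le k j hjk]

/-- This is the nesting of the kernels, which the `R k` themselves may lack: the longer product has
the shorter one as its right factor. -/
theorem nested_mul_nested_of_ge (h : IsDichotomyChain A R γ K α β) {j k : Fin (ℓ + 1)}
    (hjk : k ≤ j) : nested R j * nested R k = nested R j := by
  induction j using Fin.induction with
  | zero => rw [Fin.le_zero_iff.1 hjk, nested_zero, one_mul]
  | succ i ih =>
    rcases hjk.eq_or_lt with rfl | hlt
    · exact h.nested_mul_nested_of_le le_rfl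
    · rw [nested_succ, mul_assoc, ih (Fin.le_castSucc_iff.2 hlt)]

theorem nested_last (h : IsDichotomyChain A R γ K α β) : nested R (Fin.last ℓ) = 0 := by
  rw [← h.mul_nested _ _ le_rfl, h.last, zero_mul]

theorem exists_norm_nested_le (h : IsDichotomyChain A R γ K α β) (k : Fin (ℓ + 1)) :
    ∃ M : ℝ, 0 ≤ M ∧ ∀ n x,
      ‖(Phi A n 0 : Op d) (nested R k x)‖ ≤ M * ‖(Phi A n 0 : Op d) x‖ := by
  induction k using Fin.induction with
  | zero => exact ⟨1, zero_le_one, fun n x => by simp [nested_zero]⟩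
  | succ i ih =>
    obtain ⟨M, hM, hle⟩ := ih
    have hK := (h.dichotomy i.succ).K_pos
    refine ⟨K i.succ * M, by positivity, fun n x => ?_⟩
    rw [nested_succ, mul_assoc]
    calc _ ≤ K i.succ * ‖(Phi A n 0 : Op d) (nested R i.castSucc x)‖ :=
          (h.dichotomy i.succ).norm_le n _
      _ ≤ _ := by gcongr; exact hle n x

/-- The projector onto the `i`-th fiber along the sum of the other ones. -/
def fiberProj (R : Fin (ℓ + 1) → Op d) (i : Fin ℓ) : Op d :=
  nested R i.castSucc - nested R i.succ

theorem mul_fiberProj (h : IsDichotomyChain A R γ K α β) {i : Fin ℓ} {k : Fin (ℓ + 1)}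
    (hk : k ≤ i.castSucc) : R k * fiberProj R i = fiberProj R i := by
  rw [fiberProj, mul_sub, h.mul_nested _ _ hk,
    h.mul_nested _ _ (hk.trans (Fin.castSucc_lt_succ (i := i)).le)]

theorem succ_mul_fiberProj (h : IsDichotomyChain A R γ K α β) (i : Fin ℓ) :
    R i.succ * fiberProj R i = 0 := by
  rw [fiberProj, mul_sub, h.mul_nested _ _ le_rfl, ← nested_succ, sub_self]

theorem fiberProj_mul_self (h : IsDichotomyChain A R γ K α β) (i : Fin ℓ) :
    fiberProj R i * fiberProj R i = fiberProj R i := by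
  have hi := (Fin.castSucc_lt_succ (i := i)).le
  simp only [fiberProj, mul_sub, sub_mul, h.nested_mul_nested_of_le le_rfl,
    h.nested_mul_nested_of_le hi, h.nested_mul_nested_of_ge hi, sub_self, sub_zero]

theorem fiberProj_mul_eq_zero (h : IsDichotomyChain A R γ K α β) {i j : Fin ℓ} (hij : i ≠ j) :
    fiberProj R i * fiberProj R j = 0 := by
  rcases lt_or_gt_of_ne hij with hlt | hlt
  · have h1 : i.succ ≤ j.castSucc := Fin.le_def.2 (Fin.lt_def.1 hlt)
    have h2 : i.castSucc ≤ j.castSucc := Fin.le_def.2 (Fin.lt_def.1 hlt).le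
    have h3 : i.succ ≤ j.succ := h1.trans (Fin.castSucc_lt_succ (i := j)).le
    have h4 : i.castSucc ≤ j.succ := h2.trans (Fin.castSucc_lt_succ (i := j)).le
    simp only [fiberProj, mul_sub, sub_mul, h.nested_mul_nested_of_le h1,
      h.nested_mul_nested_of_le h2, h.nested_mul_nested_of_le h3, h.nested_mul_nested_of_le h4,
      sub_self]
  · have h1 : j.succ ≤ i.castSucc := Fin.le_def.2 (Fin.lt_def.1 hlt)
    have h2 : j.castSucc ≤ i.castSucc := Fin.le_def.2 (Fin.lt_def.1 hlt).le
    have h3 : j.succ ≤ i.succ := h1.trans (Fin.castSucc_lt_succ (i := i)).le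
    have h4 : j.castSucc ≤ i.succ := h2.trans (Fin.castSucc_lt_succ (i := i)).le
    simp only [fiberProj, mul_sub, sub_mul, h.nested_mul_nested_of_ge h1,
      h.nested_mul_nested_of_ge h2, h.nested_mul_nested_of_ge h3, h.nested_mul_nested_of_ge h4,
      sub_self]

theorem sum_fiberProj (h : IsDichotomyChain A R γ K α β) : ∑ i, fiberProj R i = 1 := by
  have h1 : ∑ i : Fin ℓ, nested R i.castSucc + nested R (Fin.last ℓ) =
      nested R 0 + ∑ i : Fin ℓ, nested R i.succ := by
    rw [← Fin.sum_univ_castSucc, Fin.sum_univ_succ]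
  rw [h.nested_last, add_zero, nested_zero] at h1
  simp only [fiberProj, Finset.sum_sub_distrib, h1, add_sub_cancel_right]

/-- On the range of `R i.castSucc` the product up to that index is the identity, so there `fiberProj
R i` is `1 - R i.succ`, whatever the other kernels are. -/
theorem range_fiberProj (h : IsDichotomyChain A R γ K α β) (i : Fin ℓ) :
    (fiberProj R i : E d →ₗ[ℝ] E d).range =
      (R i.castSucc : E d →ₗ[ℝ] E d).range ⊓ ((1 - R i.succ : Op d) : E d →ₗ[ℝ] E d).range := by
  ext x
  constructor
  · rintro ⟨y, rfl⟩
    refine ⟨⟨fiberProj R i y, ?_⟩, ⟨fiberProj R i y, ?_⟩⟩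
    · exact congrArg (fun T : Op d => T y) (h.mul_fiberProj le_rfl)
    · change fiberProj R i y - (R i.succ * fiberProj R i) y = fiberProj R i y
      rw [h.succ_mul_fiberProj]
      simp
  · rintro ⟨⟨y, rfl⟩, ⟨z, hz⟩⟩
    have h1 : R i.succ (R i.castSucc y) = 0 := by
      have h2 : (1 - R i.succ : Op d) z = R i.castSucc y := hz
      rw [← h2]
      change (R i.succ * (1 - R i.succ)) z = 0
      rw [mul_sub, (h.dichotomy i.succ).proj, mul_one, sub_self]
      rfl
    have h3 : nested R i.castSucc (R i.castSucc y) = R i.castSucc y :=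
      congrArg (fun T : Op d => T y) (h.nested_mul_of_le _ _ le_rfl)
    refine ⟨R i.castSucc y, ?_⟩
    change nested R i.castSucc (R i.castSucc y) - nested R i.succ (R i.castSucc y) = R i.castSucc y
    rw [nested_succ]
    change _ - R i.succ (nested R i.castSucc (R i.castSucc y)) = _
    rw [h3, h1, sub_zero]

/-- The single dichotomy at `i.succ` separates the two fibers: the `j`-th is stable and the `i`-th
unstable. In the product of both estimates the scaling rate `γ` cancels. -/
theorem dominated (h : IsDichotomyChain A R γ K α β) {i j : Fin ℓ} (hij : i < j) {m n : ℕ}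
    (hmn : m ≤ n) (x y : E d) :
    ‖(Phi A n 0 : Op d) (fiberProj R j x)‖ * ‖(Phi A m 0 : Op d) (fiberProj R i y)‖ ≤
      K i.succ ^ 2 * (α i.succ * β i.succ) ^ (n - m) *
        (‖(Phi A m 0 : Op d) (fiberProj R j x)‖ * ‖(Phi A n 0 : Op d) (fiberProj R i y)‖) := by
  have hd := h.dichotomy i.succ
  have hγ := hd.γ_pos
  have hK := hd.K_pos
  have hα := hd.α_mem.1
  have hβ := hd.β_mem.1
  have hj : R i.succ (fiberProj R j x) = fiberProj R j x :=
    congrArg (fun T : Op d => T x) (h.mul_fiberProj (show i.succ ≤ j.castSucc from Fin.le_def.2 (Fin.lt_def.1 hij)))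
  have hi : (1 - R i.succ) (fiberProj R i y) = fiberProj R i y := by
    change fiberProj R i y - (R i.succ * fiberProj R i) y = fiberProj R i y
    rw [h.succ_mul_fiberProj]
    simp
  have h1 := hd.stable m n hmn (fiberProj R j x)
  have h2 := hd.unstable m n hmn (fiberProj R i y)
  rw [hj] at h1
  rw [hi] at h2
  refine (mul_le_mul h1 h2 (norm_nonneg _) (by positivity)).trans (le_of_eq ?_)
  rw [show α i.succ * β i.succ = (γ i.succ * α i.succ) * (β i.succ / γ i.succ) by field_simp,
    mul_pow]
  ring

theorem exists_isDominatedSplitting (h : IsDichotomyChain A R γ K α β) :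
    ∃ M K' ρ : ℝ, IsDominatedSplitting A (fiberProj R) M K' ρ := by
  choose M hM0 hM using h.exists_norm_nested_le
  obtain ⟨p, hp⟩ := Finite.exists_max fun q : Fin (ℓ + 1) => α q * β q
  obtain ⟨q, hq⟩ := Finite.exists_max fun q : Fin (ℓ + 1) => K q ^ 2
  obtain ⟨r, hr⟩ := Finite.exists_max M
  have hα := (h.dichotomy p).α_mem
  have hβ := (h.dichotomy p).β_mem
  refine ⟨M r + M r, K q ^ 2, α p * β p, ?_⟩
  refine
    { M_nonneg := add_nonneg (hM0 r) (hM0 r)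
      K_nonneg := sq_nonneg _
      ρ_nonneg := mul_nonneg hα.1.le hβ.1.le
      ρ_lt_one := mul_lt_one_of_nonneg_of_lt_one_left hα.1.le hα.2 hβ.2.le
      sum_eq := h.sum_fiberProj
      mul_self := h.fiberProj_mul_self
      mul_eq_zero := fun i j hij => h.fiberProj_mul_eq_zero hij
      norm_le := fun i n x => ?_
      dominated := fun i j hij m n hmn x y => (h.dominated hij hmn x y).trans ?_ }
  · change ‖(Phi A n 0 : Op d) (nested R i.castSucc x - nested R i.succ x)‖ ≤ _
    rw [map_sub, add_mul]
    refine (norm_sub_le _ _).trans (add_le_add ((hM _ n x).trans ?_) ((hM _ n x).trans ?_))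
    · gcongr; exact hr _
    · gcongr; exact hr _
  · have := (h.dichotomy i.succ).α_mem.1
    have := (h.dichotomy i.succ).β_mem.1
    exact mul_le_mul_of_nonneg_right (mul_le_mul (hq _)
      (pow_le_pow_left₀ (by positivity) (hp _) _) (by positivity) (sq_nonneg _)) (by positivity)

end IsDichotomyChain

/-! ### Resolvent intervals and the chain of projectors -/

theorem resolventInterval_notMem_spectrum {A : ℕ → (Op d)ˣ} {ℓ : ℕ} {σm σp : Fin ℓ → ℝ}
    (hσ : HasSpectralIntervals A σm σp) {p : Fin (ℓ + 1)} {t : ℝ}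
    (ht : t ∈ resolventInterval σm σp p) : t ∉ dichotomySpectrum A := by
  rw [hσ.spectrum_eq, Set.mem_iUnion]
  rintro ⟨j, hj⟩
  rcases lt_or_ge j.castSucc p with hlt | hge
  · exact (ht.2.1 j hlt).not_ge hj.1
  · exact (ht.2.2 j hge).not_ge hj.2

theorem resolventInterval_lt {A : ℕ → (Op d)ˣ} {ℓ : ℕ} {σm σp : Fin ℓ → ℝ}
    (hσ : HasSpectralIntervals A σm σp) {p q : Fin (ℓ + 1)} (hpq : p < q) {s t : ℝ}
    (hs : s ∈ resolventInterval σm σp p) (ht : t ∈ resolventInterval σm σp q) : t < s := by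
  have hp : (p : ℕ) < ℓ := lt_of_lt_of_le (Fin.lt_def.1 hpq) (Nat.lt_succ_iff.1 q.2)
  exact (ht.2.1 ⟨p, hp⟩ hpq).trans_le ((hσ.le ⟨p, hp⟩).trans (hs.2.2 ⟨p, hp⟩ le_rfl).le)

/-- All relations are read off from the growth description of the ranges: above the spectrum every
orbit qualifies, below it none but zero, and the condition weakens as the rate increases. -/
theorem IsProjectorSystem.exists_isDichotomyChain {A : ℕ → (Op d)ˣ} (hA : BoundedInvertible A)
    {ℓ : ℕ} {σm σp : Fin ℓ → ℝ} (hσ : HasSpectralIntervals A σm σp)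
    {P : Fin (ℓ + 1) → ℕ → Op d} (hP : IsProjectorSystem A σm σp P) :
    ∃ γ K α β, IsDichotomyChain A (fun p => P p 0) γ K α β := by
  choose γ hγ K α β hdich using hP
  have hd : ∀ p, OrbitDichotomy A (γ p) (K p) (α p) (β p) (P p 0) := fun p =>
    (hdich p).orbitDichotomy (hγ p).1
  refine ⟨fun p => γ p, K, α, β, hd, ?_, ?_, fun p q hpq => ?_⟩
  · ext1 x
    refine ((hd 0).growthLE_self_iff x).1
      (growthLE_of_forall_le_notMem hA (hγ 0).1 (fun t ht => ?_) x)
    refine resolventInterval_notMem_spectrum hσ (p := 0) ⟨(hγ 0).1.trans_le ht, fun j hj => ?_,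
      fun j hj => ((hγ 0).2.2 j hj).trans_le ht⟩
    exact absurd hj (Fin.not_lt_zero _)
  · ext1 x
    have hx : P (Fin.last ℓ) 0 (P (Fin.last ℓ) 0 x) = P (Fin.last ℓ) 0 x :=
      congrArg (fun T : Op d => T x) (hd (Fin.last ℓ)).proj
    refine eq_zero_of_growthLE hA (hγ (Fin.last ℓ)).1 (fun t ht0 ht => ?_)
      (((hd (Fin.last ℓ)).growthLE_self_iff _).2 hx)
    refine resolventInterval_notMem_spectrum hσ (p := Fin.last ℓ) ⟨ht0,
      fun j hj => ht.trans_lt ((hγ (Fin.last ℓ)).2.1 j hj), fun j hj => ?_⟩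
    exact absurd hj (Fin.castSucc_lt_last j).not_ge
  · ext1 x
    rcases hpq.eq_or_lt with rfl | hlt
    · exact congrArg (fun T : Op d => T x) (hd p).proj
    have hx : P q 0 (P q 0 x) = P q 0 x := congrArg (fun T : Op d => T x) (hd q).proj
    exact ((hd p).growthLE_self_iff _).1 ((((hd q).growthLE_self_iff _).2 hx).mono (hγ q).1
      (resolventInterval_lt hσ hlt (hγ p) (hγ q)).le)

/-- The spectral fibers at time `0` are the ranges of the projectors of a dominated splitting. -/
theorem exists_isDominatedSplitting_range_eq_fiber {A : ℕ → (Op d)ˣ} (hA : BoundedInvertible A)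
    {ℓ : ℕ} {σm σp : Fin ℓ → ℝ} (hσ : HasSpectralIntervals A σm σp)
    {P : Fin (ℓ + 1) → ℕ → Op d} (hP : IsProjectorSystem A σm σp P) :
    ∃ (Q : Fin ℓ → Op d) (M K ρ : ℝ), IsDominatedSplitting A Q M K ρ ∧
      ∀ i, (Q i : E d →ₗ[ℝ] E d).range = fiber P 0 i := by
  obtain ⟨γ, K, α, β, h⟩ := hP.exists_isDichotomyChain hA hσ
  obtain ⟨M, K', ρ, h'⟩ := h.exists_isDominatedSplitting
  exact ⟨_, M, K', ρ, h', h.range_fiberProj⟩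

/-! ### Suprema over the Grassmannian and over the trace spaces -/

theorem grassmannian_nonempty {s : ℕ} (hs : s ≤ d) : (grassmannian s d).Nonempty := by
  have hb := (EuclideanSpace.basisFun (Fin d) ℝ).toBasis.linearIndependent.comp
    (Fin.castLE hs) (Fin.castLE_injective hs)
  exact ⟨_, (finrank_span_eq_card hb).trans (Fintype.card_fin s)⟩

/-- Both families give the same set of values. The bound `c` and the nonempty Grassmannian ensure
that the real `⨆` is a true supremum and not the default `0`. -/
theorem isLUB_image_traceSpaces {ℓ : ℕ} {P : Fin (ℓ + 1) → ℕ → Op d} {s : ℕ} (hs : s ≤ d)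
    {r : Submodule ℝ (E d) → ℝ} {c : ℝ} (hr : ∀ V, r V ≤ c)
    (htrace : ∀ V ∈ grassmannian s d, ∃ W ∈ traceSpaces P 0 s, r V = r W) :
    IsLUB (r '' traceSpaces P 0 s) (⨆ V : grassmannian s d, r V) := by
  have h1 : r '' traceSpaces P 0 s = Set.range fun V : grassmannian s d => r V := by
    ext t
    constructor
    · rintro ⟨W, hW, rfl⟩
      exact ⟨⟨W, hW.1⟩, rfl⟩
    · rintro ⟨⟨V, hV⟩, rfl⟩
      obtain ⟨W, hW, hVW⟩ := htrace V hV
      exact ⟨W, hW, hVW.symm⟩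
  have : Nonempty (grassmannian s d) := (grassmannian_nonempty hs).to_subtype
  rw [h1]
  exact isLUB_ciSup ⟨c, by rintro _ ⟨V, rfl⟩; exact hr V⟩

theorem IsDominatedSplitting.exists_traceSpace {A : ℕ → (Op d)ˣ} {ℓ : ℕ} {Q : Fin ℓ → Op d}
    {M K ρ : ℝ} (h : IsDominatedSplitting A Q M K ρ) {P : Fin (ℓ + 1) → ℕ → Op d}
    (hQ : ∀ i, (Q i : E d →ₗ[ℝ] E d).range = fiber P 0 i) {s : ℕ} (hs : 1 ≤ s)
    {V : Submodule ℝ (E d)} (hV : V ∈ grassmannian s d) :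
    ∃ W ∈ traceSpaces P 0 s, upperRate A V = upperRate A W ∧ lowerRate A V = lowerRate A W := by
  have hV' : Module.finrank ℝ V = s := hV
  refine ⟨⨆ i, gradedPiece Q V i, ⟨(h.finrank_iSup_gradedPiece V).trans hV, gradedPiece Q V,
    fun i => hQ i ▸ gradedPiece_le Q V i, h.iSupIndep_of_le_range (gradedPiece_le Q V), rfl,
    (h.sum_finrank_gradedPiece V).trans hV⟩, h.rates_eq (by omega)⟩

end AngVal

end

theorem theorem3p7 {d : ℕ} (hd : 1 ≤ d) (A : ℕ → (AngVal.Op d)ˣ)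
    (hA : AngVal.BoundedInvertible A)
    {ℓ : ℕ} (σm σp : Fin ℓ → ℝ) (hσ : AngVal.HasSpectralIntervals A σm σp)
    (P : Fin (ℓ + 1) → ℕ → AngVal.Op d) (hP : AngVal.IsProjectorSystem A σm σp P) :
    -- the limits in the uniform outer angular values exist, and the suprema over all subspaces
    -- are the suprema over the trace spaces at time zero
    (∀ s : ℕ, 1 ≤ s → s ≤ d →
      (∀ V ∈ AngVal.grassmannian s d,
        Tendsto (AngVal.supMean A V) atTop (𝓝 (AngVal.upperRate A V)) ∧
        Tendsto (AngVal.infMean A V) atTop (𝓝 (AngVal.lowerRate A V))) ∧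
      IsLUB (AngVal.upperRate A '' AngVal.traceSpaces P 0 s) (AngVal.upperUniformOuter A s) ∧
      IsLUB (AngVal.lowerRate A '' AngVal.traceSpaces P 0 s) (AngVal.lowerUniformOuter A s)) ∧
    -- the limits in the first uniform inner angular values exist, and the value of the system is
    -- the maximum of the values of the spectral fibers at time zero
    Tendsto (AngVal.innerMean A 1) atTop (𝓝 (AngVal.upperUniformInner A 1)) ∧
    (∀ i : Fin ℓ, Tendsto (AngVal.innerMeanOn A (AngVal.fiber P 0 i)) atTop
      (𝓝 (AngVal.innerOn A (AngVal.fiber P 0 i)))) ∧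
    IsGreatest (Set.range fun i : Fin ℓ => AngVal.innerOn A (AngVal.fiber P 0 i))
      (AngVal.upperUniformInner A 1) := by
  obtain ⟨Q, M, K, ρ, h, hQ⟩ := AngVal.exists_isDominatedSplitting_range_eq_fiber hA hσ hP
  refine ⟨fun s hs1 hs => ⟨fun V _ => ⟨AngVal.tendsto_supMean A V, AngVal.tendsto_infMean A V⟩,
    AngVal.isLUB_image_traceSpaces hs (AngVal.upperRate_le A) fun V hV => ?_,
    AngVal.isLUB_image_traceSpaces hs (AngVal.lowerRate_le A) fun V hV => ?_⟩,
    AngVal.tendsto_innerMean A 1, fun i => AngVal.tendsto_innerMeanOn A _, ?_, ?_⟩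
  · obtain ⟨W, hW, h1, -⟩ := h.exists_traceSpace hQ hs1 hV
    exact ⟨W, hW, h1⟩
  · obtain ⟨W, hW, -, h1⟩ := h.exists_traceSpace hQ hs1 hV
    exact ⟨W, hW, h1⟩
  -- Without spectral intervals the identity would be an empty sum of projectors, contradicting `1 ≤
  -- d`.
  · have hℓ : Nonempty (Fin ℓ) := by
      by_contra hemp
      rw [not_nonempty_iff] at hemp
      have hzero : ∀ x : AngVal.E d, x = 0 := fun x => by
        rw [← h.sum_apply x]
        simp
      have hone := hzero (EuclideanSpace.single ⟨0, hd⟩ 1)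
      simp at hone
    obtain ⟨i, hi⟩ := Finite.exists_max fun i => AngVal.innerOn A (AngVal.fiber P 0 i)
    refine ⟨i, le_antisymm (AngVal.innerOn_le_upperUniformInner A _) ?_⟩
    exact h.upperUniformInner_le hA (AngVal.innerOn_nonneg A _) fun j => by
      rw [hQ]
      exact hi j
  · rintro _ ⟨i, rfl⟩
    exact AngVal.innerOn_le_upperUniformInner A _
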